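/- All Lie algebras are finite-dimensional over $\mathbb C$; they are given by the listed products of basis vectors, extended skew-symmetrically, and products not listed are zero. The nilradical of a Lie algebra is its largest nilpotent ideal. Define, on the basis $x,e_1,\dots,e_n$ (for $\mathfrak s^1_{n,1}$), $x,e_1,\dots,e_{2m}$ (for $\tau^1_{2m,1},\tau^2_{2m,1}$), $e_1,\dots,e_{n+1}$ (for $L_k$), and $x,e_1,\dots,e_{n+1}$ (for $\widetilde L_k$): * $\mathfrak s^1_{n,1}(\beta)$: $[e_i,e_1]=e_{i+1}$ $(2\le i\le n-1)$, $[e_1,x]=e_1$, $[e_i,x]=(i-2+\beta)e_i$ $(2\le i\le n)$; * $\tau^1_{2m,1}(\alpha)$: $[e_i,e_1]=e_{i+1}$ $(2\le i\le 2m-2)$, $[e_i,e_{2m+1-i}]=(-1)^ie_{2m}$ $(2\le i\le m)$, $[e_1,x]=e_1$, $[e_i,x]=(i-2+\alpha)e_i$ $(2\le i\le 2m-1)$, $[e_{2m},x]=(2m-3+2\alpha)e_{2m}$; * $\tau^2_{2m,1}$: $[e_i,e_1]=e_{i+1}$ $(2\le i\le 2m-2)$, $[e_i,e_{2m+1-i}]=(-1)^ie_{2m}$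 $(2\le i\le m)$, $[e_1,x]=e_1+e_{2m}$, $[e_i,x]=(i-m)e_i$ $(2\le i\le 2m-1)$, $[e_{2m},x]=e_{2m}$; * $L_k$ $(2\le k\le\lfloor n/2\rfloor)$: $[e_i,e_1]=e_{i+1}$ $(2\le i\le n)$, $[e_i,e_{2k+1-i}]=(-1)^ie_{n+1}$ $(2\le i\le k)$; * $\widetilde L_k$ $(2\le k\le\lfloor n/2\rfloor)$: the products of $L_k$ together with $[e_1,x]=e_1$, $[e_i,x]=(n+i-2k)e_i$ $(2\le i\le n+1)$. A one-dimensional (non-split) extension of a solvable Lie algebra $L$ with nilradical $N$ is a Lie algebra $\widetilde L$ with a short exact sequence $0\to V\to\widetilde L\to L\to 0$, $\dim V=1$, such that the nilradical $\widetilde N$ of $\widetilde L$ is the preimage of $N$, and the centre of $\widetilde N$ is exactly $V$ (so that $\widetilde N$ is a non-split central extension of $N$ by $V$). **Theorem.** Let $n\ge 2$, $\beta\in\mathbb C$, and let $\widetilde L$ be a one-dimensional (non-split) extension of $\mathfrak s^1_{n,1}(\beta)$. Then $\widetilde L$ is isomorphic to one of the following algebras: 1. $\mathfrak s^1_{n+1,1}(\beta)$;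 2. $\tau^1_{n+1,1}(\beta)$, where $n$ is odd; 3. $\tau^2_{n+1,1}$, where $n$ is odd and $\beta=\frac{3-n}{2}$; 4. $\widetilde L_k$ for some $2\le k\le\lfloor n/2\rfloor$ with $\beta=n+2-2k$. Moreover, for every $2\le k\le\lfloor n/2\rfloor$ the nilradical of $\widetilde L_k$ is isomorphic to $L_k$. -/

import Mathlib

/-! Complex Lie algebras given by multiplication tables, and non-split extensions. -/

noncomputable section

namespace FiliformExt

/-- Coordinate vectors with respect to a basis `e_a, …, e_b`. -/
abbrev Coord (a b : ℕ) : Type := ↥(Finset.Icc a b) → ℂ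

/-- The basis vector `e_k` of `Coord a b` (it is `0` if `k` is not one of `a, …, b`). -/
def e {a b : ℕ} (k : ℕ) : Coord a b := fun l => if (l : ℕ) = k then 1 else 0

/-- The skew-symmetric bilinear product determined by the listed products `[e_i, e_j] = t i j`:
each listed product is also read as `[e_j, e_i] = - t i j`, and products that are not listed
(`t i j = 0` and `t j i = 0`) are zero. -/
def tableBracket {a b : ℕ} (t : ℕ → ℕ → Coord a b) (u v : Coord a b) : Coord a b :=
  ∑ i, ∑ j, (u i * v j) • (t i j - t j i)

/-- A multiplication table, on a basis `e_a, …, e_b`, whose skew-symmetric product satisfies the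
Jacobi identity. -/
structure LieTable (a b : ℕ) where
  t : ℕ → ℕ → Coord a b
  jacobi : ∀ u v w : Coord a b,
    tableBracket t u (tableBracket t v w) + tableBracket t v (tableBracket t w u)
      + tableBracket t w (tableBracket t u v) = 0

/-- The complex Lie algebra with the given multiplication table. -/
def LieTable.Alg {a b : ℕ} (_T : LieTable a b) : Type := Coord a b

section Bracket

variable {a b : ℕ} (t : ℕ → ℕ → Coord a b)

theorem tableBracket_add_left (u u' v : Coord a b) :
    tableBracket t (u + u') v = tableBracket t u v + tableBracket t u' v := by
  simp only [tableBracket, Pi.add_apply, add_mul, add_smul, Finset.sum_add_distrib]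

theorem tableBracket_add_right (u v v' : Coord a b) :
    tableBracket t u (v + v') = tableBracket t u v + tableBracket t u v' := by
  simp only [tableBracket, Pi.add_apply, mul_add, add_smul, Finset.sum_add_distrib]

theorem tableBracket_smul_left (c : ℂ) (u v : Coord a b) :
    tableBracket t (c • u) v = c • tableBracket t u v := by
  simp only [tableBracket, Pi.smul_apply, smul_eq_mul, mul_assoc, Finset.smul_sum, mul_smul]

theorem tableBracket_smul_right (c : ℂ) (u v : Coord a b) :
    tableBracket t u (c • v) = c • tableBracket t u v := by
  simp only [tableBracket, Pi.smul_apply, smul_eq_mul, Finset.smul_sum, smul_smul]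
  refine Finset.sum_congr rfl fun i _ => Finset.sum_congr rfl fun j _ => ?_
  congr 1
  ring

theorem tableBracket_swap (u v : Coord a b) : tableBracket t u v = - tableBracket t v u := by
  unfold tableBracket
  rw [Finset.sum_comm, ← Finset.sum_neg_distrib]
  refine Finset.sum_congr rfl fun i _ => ?_
  rw [← Finset.sum_neg_distrib]
  refine Finset.sum_congr rfl fun j _ => ?_
  rw [← smul_neg, neg_sub, mul_comm]

theorem tableBracket_self (u : Coord a b) : tableBracket t u u = 0 := by
  have h := tableBracket_swap t u u
  exact self_eq_neg.mp h

/-- The product as a bilinear map. -/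
def tableBilin : Coord a b →ₗ[ℂ] Coord a b →ₗ[ℂ] Coord a b :=
  LinearMap.mk₂ ℂ (tableBracket t) (tableBracket_add_left t) (tableBracket_smul_left t)
    (tableBracket_add_right t) (tableBracket_smul_right t)

theorem tableBilin_apply (u v : Coord a b) : tableBilin t u v = tableBracket t u v := rfl

theorem e_eq_single (i : ↥(Finset.Icc a b)) :
    (e (i : ℕ) : Coord a b) = Pi.single i 1 := by
  funext l
  by_cases h : l = i
  · subst h; simp [e]
  · have h2 : (l : ℕ) ≠ i := fun h3 => h (Subtype.ext h3)
    simp [e, h2, h]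

theorem tableBracket_e (i j : ℕ) (hi : i ∈ Finset.Icc a b) (hj : j ∈ Finset.Icc a b) :
    tableBracket t (e i) (e j) = t i j - t j i := by
  have h1 := e_eq_single (a := a) (b := b) ⟨i, hi⟩
  have h2 := e_eq_single (a := a) (b := b) ⟨j, hj⟩
  simp only at h1 h2
  rw [h1, h2]
  unfold tableBracket
  rw [Finset.sum_eq_single ⟨i, hi⟩, Finset.sum_eq_single ⟨j, hj⟩]
  · simp
  · intro l _ hl; simp [hl]
  · simp
  · intro l _ hl; simp [hl]
  · simp

/-- It is enough to check the Jacobi identity on increasing triples of basis vectors. -/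
theorem jacobi_of_basis
    (h : ∀ i j k : ℕ, i ∈ Finset.Icc a b → j ∈ Finset.Icc a b → k ∈ Finset.Icc a b →
      i < j → j < k →
      tableBracket t (e i) (t j k - t k j) + tableBracket t (e j) (t k i - t i k)
        + tableBracket t (e k) (t i j - t j i) = 0) (u v w : Coord a b) :
    tableBracket t u (tableBracket t v w) + tableBracket t v (tableBracket t w u)
      + tableBracket t w (tableBracket t u v) = 0 := by
  have hs : ∀ x y : ℕ, t x y - t y x = - (t y x - t x y) := fun x y => by rw [neg_sub]
  have hn : ∀ p q : Coord a b, tableBracket t p (-q) = - tableBracket t p q := fun p q => by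
    rw [← neg_one_smul ℂ q, tableBracket_smul_right, neg_one_smul]
  have hz : ∀ p : Coord a b, tableBracket t p 0 = 0 := fun p => by
    rw [← tableBilin_apply, map_zero]
  have key : ∀ i j k : ↥(Finset.Icc a b),
      tableBracket t (e i) (tableBracket t (e j) (e k))
        + tableBracket t (e j) (tableBracket t (e k) (e i))
        + tableBracket t (e k) (tableBracket t (e i) (e j)) = 0 := by
    rintro ⟨i, hi⟩ ⟨j, hj⟩ ⟨k, hk⟩
    simp only
    rw [tableBracket_e t j k hj hk, tableBracket_e t k i hk hi, tableBracket_e t i j hi hj]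
    rcases lt_trichotomy i j with hij | hij | hij
    · rcases lt_trichotomy j k with hjk | hjk | hjk
      · exact h i j k hi hj hk hij hjk
      · subst hjk
        rw [sub_self, hz, hs j i, hn]; abel
      · rcases lt_trichotomy i k with hik | hik | hik
        · have := h i k j hi hk hj hik hjk
          rw [hs j k, hs k i, hs i j, hn, hn, hn, ← neg_eq_zero, ← this]; abel
        · subst hik
          rw [sub_self, hz, hs j i, hn]; abel
        · have := h k i j hk hi hj hik hij
          rw [← this]; abel
    · subst hij
      rw [sub_self, hz, hs i k, hn]; abel
    · rcases lt_trichotomy i k with hik | hik | hik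
      · have := h j i k hj hi hk hij hik
        rw [hs j k, hs k i, hs i j, hn, hn, hn, ← neg_eq_zero, ← this]; abel
      · subst hik
        rw [sub_self, hz, hs j i, hn]; abel
      · rcases lt_trichotomy j k with hjk | hjk | hjk
        · have := h j k i hj hk hi hjk hik
          rw [← this]; abel
        · subst hjk
          rw [sub_self, hz, hs j i, hn]; abel
        · have := h k j i hk hj hi hjk hij
          rw [hs j k, hs k i, hs i j, hn, hn, hn, ← neg_eq_zero, ← this]; abel
  let B := tableBilin t
  have hB : ∀ p q, B p q = tableBracket t p q := fun p q => rfl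
  have hsum : ∀ p : Coord a b, p = ∑ i, p i • (e (i : ℕ) : Coord a b) := by
    intro p
    simp only [e_eq_single]
    funext l
    simp [Finset.sum_apply, Pi.single_apply]
  have step1 : ∀ (i j : ↥(Finset.Icc a b)) (w : Coord a b),
      B (e i) (B (e j) w) + B (e j) (B w (e i)) + B w (B (e i) (e j)) = 0 := by
    intro i j w
    rw [hsum w]
    simp only [map_sum, map_smul, LinearMap.sum_apply, LinearMap.smul_apply,
      ← Finset.sum_add_distrib, ← smul_add]
    exact Finset.sum_eq_zero fun k _ => by rw [hB, hB, hB, hB, hB, hB, key, smul_zero]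
  have step2 : ∀ (i : ↥(Finset.Icc a b)) (v w : Coord a b),
      B (e i) (B v w) + B v (B w (e i)) + B w (B (e i) v) = 0 := by
    intro i v w
    rw [hsum v]
    simp only [map_sum, map_smul, LinearMap.sum_apply, LinearMap.smul_apply,
      ← Finset.sum_add_distrib, ← smul_add]
    exact Finset.sum_eq_zero fun k _ => by rw [step1, smul_zero]
  have step3 : B u (B v w) + B v (B w u) + B w (B u v) = 0 := by
    rw [hsum u]
    simp only [map_sum, map_smul, LinearMap.sum_apply, LinearMap.smul_apply,
      ← Finset.sum_add_distrib, ← smul_add]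
    exact Finset.sum_eq_zero fun k _ => by rw [step2, smul_zero]
  exact step3

theorem leibniz_of_jacobi (u v w : Coord a b)
    (h : tableBracket t u (tableBracket t v w) + tableBracket t v (tableBracket t w u)
      + tableBracket t w (tableBracket t u v) = 0) :
    tableBracket t u (tableBracket t v w)
      = tableBracket t (tableBracket t u v) w + tableBracket t v (tableBracket t u w) := by
  have h1 := tableBracket_swap t w (tableBracket t u v)
  have h2 : tableBracket t v (tableBracket t w u)
      = - tableBracket t v (tableBracket t u w) := by
    rw [tableBracket_swap t w u, ← neg_one_smul ℂ (tableBracket t u w),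
      tableBracket_smul_right, neg_one_smul]
  rw [h1, h2, add_assoc, add_eq_zero_iff_eq_neg] at h
  rw [h]
  abel

/-- A common normal form of all the tables below, used only to verify the Jacobi identity. -/
def genTable (r s : ℕ) (ε : ℂ) (w : ℕ → ℂ) (i j : ℕ) : Coord a b :=
  (if 2 ≤ i ∧ i ≤ r ∧ j = 1 then e (i + 1) else 0)
    + (if 2 ≤ i ∧ i < j ∧ i + j = s then (-1 : ℂ) ^ i • e b else 0)
    + (if i = 1 ∧ j = 0 then e 1 + ε • e b else 0)
    + (if 2 ≤ i ∧ j = 0 then w i • e i else 0)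

theorem genTable_one (r s : ℕ) (ε : ℂ) (w : ℕ → ℂ) (x : ℕ) (hx : 2 ≤ x) :
    (genTable r s ε w x 1 : Coord a b) = if x ≤ r then e (x + 1) else 0 := by
  unfold genTable
  rw [if_neg (show ¬(2 ≤ x ∧ x < 1 ∧ x + 1 = s) by omega),
    if_neg (show ¬(x = 1 ∧ 1 = 0) by omega), if_neg (show ¬(2 ≤ x ∧ 1 = 0) by omega)]
  simp [hx]

theorem genTable_one_left (r s : ℕ) (ε : ℂ) (w : ℕ → ℂ) (x : ℕ) (hx : 2 ≤ x) :
    (genTable r s ε w 1 x : Coord a b) = 0 := by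
  unfold genTable
  rw [if_neg (show ¬(2 ≤ 1 ∧ 1 ≤ r ∧ x = 1) by omega),
    if_neg (show ¬(2 ≤ 1 ∧ 1 < x ∧ 1 + x = s) by omega),
    if_neg (show ¬(1 = 1 ∧ x = 0) by omega), if_neg (show ¬(2 ≤ 1 ∧ x = 0) by omega)]
  simp

theorem genTable_zero (r s : ℕ) (ε : ℂ) (w : ℕ → ℂ) (x : ℕ) (hx : 2 ≤ x) :
    (genTable r s ε w x 0 : Coord a b) = w x • e x := by
  unfold genTable
  rw [if_neg (show ¬(2 ≤ x ∧ x ≤ r ∧ 0 = 1) by omega),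
    if_neg (show ¬(2 ≤ x ∧ x < 0 ∧ x + 0 = s) by omega),
    if_neg (show ¬(x = 1 ∧ 0 = 0) by omega), if_pos (show 2 ≤ x ∧ 0 = 0 from ⟨hx, rfl⟩)]
  simp

theorem genTable_zero_left (r s : ℕ) (ε : ℂ) (w : ℕ → ℂ) (x : ℕ) :
    (genTable r s ε w 0 x : Coord a b) = 0 := by
  unfold genTable
  rw [if_neg (show ¬(2 ≤ 0 ∧ 0 ≤ r ∧ x = 1) by omega),
    if_neg (show ¬(2 ≤ 0 ∧ 0 < x ∧ 0 + x = s) by omega),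
    if_neg (show ¬(0 = 1 ∧ x = 0) by omega), if_neg (show ¬(2 ≤ 0 ∧ x = 0) by omega)]
  simp

theorem genTable_pair (r s : ℕ) (ε : ℂ) (w : ℕ → ℂ) (x y : ℕ) (hx : 2 ≤ x) (hy : 2 ≤ y) :
    (genTable r s ε w x y : Coord a b)
      = if x < y ∧ x + y = s then (-1 : ℂ) ^ x • e b else 0 := by
  unfold genTable
  rw [if_neg (show ¬(2 ≤ x ∧ x ≤ r ∧ y = 1) by omega),
    if_neg (show ¬(x = 1 ∧ y = 0) by omega), if_neg (show ¬(2 ≤ x ∧ y = 0) by omega)]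
  simp [hx]

theorem jacobi_of_gen (r s : ℕ) (ε : ℂ) (w : ℕ → ℂ)
    (ht : ∀ i j, i ∈ Finset.Icc a b → j ∈ Finset.Icc a b → i ≠ j →
      t i j = genTable r s ε w i j)
    (hr : 2 ≤ b → r < b) (hs : s ≤ b + 1) (hsr : 2 ≤ b → s ≤ r + 3) (hodd : s = 0 ∨ Odd s)
    (hw1 : ∀ i, 2 ≤ i → i ≤ r → w (i + 1) = w i + 1)
    (hw2 : ∀ i j, 2 ≤ i → 2 ≤ j → i + j = s → w i + w j = w b)
    (u v w' : Coord a b) :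
    tableBracket t u (tableBracket t v w') + tableBracket t v (tableBracket t w' u)
      + tableBracket t w' (tableBracket t u v) = 0 := by
  refine jacobi_of_basis t ?_ u v w'
  intro i j k hi hj hk hij hjk
  have hb : 2 ≤ b := by simp only [Finset.mem_Icc] at hk; omega
  have hrb := hr hb
  have hsr2 := hsr hb
  have hbm : b ∈ Finset.Icc a b := by simp only [Finset.mem_Icc] at hk ⊢; omega
  have ha : ∀ p q : Coord a b, ∀ l, tableBracket t (e l) (p + q)
      = tableBracket t (e l) p + tableBracket t (e l) q := fun p q l =>
    tableBracket_add_right t _ _ _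
  have hsm : ∀ (c : ℂ) (p : Coord a b), ∀ l, tableBracket t (e l) (c • p)
      = c • tableBracket t (e l) p := fun c p l => tableBracket_smul_right t c _ _
  have hn : ∀ p : Coord a b, ∀ l, tableBracket t (e l) (-p) = - tableBracket t (e l) p :=
    fun p l => by rw [← neg_one_smul ℂ p, tableBracket_smul_right, neg_one_smul]
  have hz : ∀ p : Coord a b, tableBracket t p 0 = 0 := fun p => by
    rw [← tableBilin_apply, map_zero]
  have d : ∀ x y, x ∈ Finset.Icc a b → y ∈ Finset.Icc a b → x ≠ y →
      t x y - t y x = genTable r s ε w x y - genTable r s ε w y x := fun x y hx hy hxy => by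
    rw [ht x y hx hy hxy, ht y x hy hx hxy.symm]
  -- the products of the basis vectors
  have b1 : ∀ x, 2 ≤ x → x ∈ Finset.Icc a b → 1 ∈ Finset.Icc a b →
      t x 1 - t 1 x = if x ≤ r then e (x + 1) else 0 := by
    intro x hx h1 h2
    rw [d x 1 h1 h2 (by omega), genTable_one _ _ _ _ _ hx, genTable_one_left _ _ _ _ _ hx,
      sub_zero]
  have b0 : ∀ x, 2 ≤ x → x ∈ Finset.Icc a b → 0 ∈ Finset.Icc a b →
      t x 0 - t 0 x = w x • e x := by
    intro x hx h1 h2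
    rw [d x 0 h1 h2 (by omega), genTable_zero _ _ _ _ _ hx, genTable_zero_left, sub_zero]
  have b10 : 1 ∈ Finset.Icc a b → 0 ∈ Finset.Icc a b →
      t 1 0 - t 0 1 = e 1 + ε • e b := by
    intro h1 h2
    rw [d 1 0 h1 h2 (by omega)]
    simp [genTable]
  have bq : ∀ x y, 2 ≤ x → 2 ≤ y → x ∈ Finset.Icc a b → y ∈ Finset.Icc a b →
      t x y - t y x = if x + y = s then (-1 : ℂ) ^ x • e b else 0 := by
    intro x y hx hy h1 h2
    by_cases hxy : x = y
    · subst hxy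
      rw [sub_self, if_neg]
      rintro hxs
      rcases hodd with h | ⟨c, h⟩ <;> omega
    · rw [d x y h1 h2 hxy]
      rw [genTable_pair _ _ _ _ _ _ hx hy, genTable_pair _ _ _ _ _ _ hy hx]
      by_cases hxs : x + y = s
      · have hpar : (-1 : ℂ) ^ y = - (-1) ^ x := by
          rcases hodd with h | ⟨c, h⟩
          · omega
          · rcases Nat.even_or_odd x with hx2 | hx2
            · have : Odd y := by
                rcases hx2 with ⟨f, hf⟩; exact ⟨c - f, by omega⟩
              rw [hx2.neg_one_pow, this.neg_one_pow]
            · have : Even y := by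
                rcases hx2 with ⟨f, hf⟩; exact ⟨c - f, by omega⟩
              rw [hx2.neg_one_pow, this.neg_one_pow, neg_neg]
        rcases lt_or_gt_of_ne hxy with hlt | hlt
        · rw [if_pos ⟨hlt, hxs⟩, if_neg (by omega), if_pos hxs, sub_zero]
        · rw [if_neg (by omega), if_pos ⟨hlt, by omega⟩, if_pos hxs, hpar]
          module
      · rw [if_neg (by omega), if_neg (by omega), if_neg hxs, sub_zero]
  have bqb : ∀ x, 2 ≤ x → x ∈ Finset.Icc a b → tableBracket t (e x) (e b) = 0 := by
    intro x hx h1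
    rw [tableBracket_e t x b h1 hbm, bq x b hx hb h1 hbm, if_neg (by omega)]
  have sw : ∀ x y, t x y - t y x = - (t y x - t x y) := fun x y => by rw [neg_sub]
  have hi2 := Finset.mem_Icc.mp hi
  have hj2 := Finset.mem_Icc.mp hj
  have hk2 := Finset.mem_Icc.mp hk
  have hmem : ∀ x, i ≤ x → x ≤ b → x ∈ Finset.Icc a b := fun x h1 h2 =>
    Finset.mem_Icc.mpr ⟨by omega, h2⟩
  by_cases hi0 : i = 0
  · subst hi0
    by_cases hj1 : j = 1
    · subst hj1
      rw [sw 1 k, b1 k (by omega) hk hj, b0 k (by omega) hk hi, sw 0 1, b10 hj hi]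
      simp only [hn, ha, hsm, bqb k (by omega) hk, smul_zero, add_zero]
      rw [tableBracket_e t 1 k hj hk, sw 1 k, tableBracket_e t k 1 hk hj,
        b1 k (by omega) hk hj]
      by_cases hkr : k ≤ r
      · simp only [if_pos hkr]
        have hk1 : k + 1 ∈ Finset.Icc a b := hmem _ (by omega) (by omega)
        rw [tableBracket_e t 0 (k + 1) hi hk1, sw 0 (k + 1), b0 (k + 1) (by omega) hk1 hi,
          hw1 k (by omega) hkr]
        module
      · simp [if_neg hkr, hz]
    · rw [bq j k (by omega) (by omega) hj hk, b0 k (by omega) hk hi, sw 0 j,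
        b0 j (by omega) hj hi]
      simp only [hn, hsm]
      rw [tableBracket_e t j k hj hk, bq j k (by omega) (by omega) hj hk,
        tableBracket_e t k j hk hj, sw k j, bq j k (by omega) (by omega) hj hk]
      by_cases hjs : j + k = s
      · simp only [if_pos hjs, hsm]
        rw [tableBracket_e t 0 b hi hbm, sw 0 b, b0 b hb hbm hi,
          ← hw2 j k (by omega) (by omega) hjs]
        module
      · simp [if_neg hjs, hz]
  · by_cases hi1 : i = 1
    · subst hi1
      rw [bq j k (by omega) (by omega) hj hk, b1 k (by omega) hk hi, sw 1 j,
        b1 j (by omega) hj hi]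
      have f1 : tableBracket t (e 1) (if j + k = s then (-1 : ℂ) ^ j • e b else 0) = 0 := by
        split_ifs
        · rw [hsm, tableBracket_e t 1 b hi hbm, sw 1 b, b1 b hb hbm hi, if_neg (by omega)]
          simp
        · exact hz _
      rw [f1, zero_add, hn]
      have f2 : ∀ x y, 2 ≤ x → 2 ≤ y → x ∈ Finset.Icc a b → y ∈ Finset.Icc a b →
          tableBracket t (e x) (if y ≤ r then e (y + 1) else 0)
            = if x + y + 1 = s then (-1 : ℂ) ^ x • e b else 0 := by
        intro x y hx hy h1 h2
        by_cases hyr : y ≤ r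
        · rw [if_pos hyr]
          have hy1 : y + 1 ∈ Finset.Icc a b := by
            simp only [Finset.mem_Icc] at h2 ⊢; omega
          rw [tableBracket_e t x (y + 1) h1 hy1, bq x (y + 1) hx (by omega) h1 hy1]
          rfl
        · rw [if_neg hyr, hz, if_neg (by omega)]
      rw [f2 j k (by omega) (by omega) hj hk, f2 k j (by omega) (by omega) hk hj]
      by_cases hjs : j + k + 1 = s
      · rw [if_pos hjs, if_pos (by omega)]
        have hpar : (-1 : ℂ) ^ j = (-1) ^ k := by
          rcases hodd with h | ⟨c, h⟩
          · omega
          · have h3 : (-1 : ℂ) ^ (j + k) = 1 := by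
              have : Even (j + k) := ⟨c, by omega⟩
              exact this.neg_one_pow
            rw [pow_add] at h3
            rcases neg_one_pow_eq_or ℂ j with h4 | h4 <;>
              rcases neg_one_pow_eq_or ℂ k with h5 | h5 <;>
              rw [h4, h5] at h3 ⊢ <;> norm_num at h3
        rw [hpar]; simp
      · rw [if_neg hjs, if_neg (by omega)]; simp
    · have f3 : ∀ x y z, 2 ≤ x → 2 ≤ y → 2 ≤ z → x ∈ Finset.Icc a b → y ∈ Finset.Icc a b →
          z ∈ Finset.Icc a b → tableBracket t (e x) (t y z - t z y) = 0 := by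
        intro x y z hx hy hz2 h1 h2 h3
        rw [bq y z hy hz2 h2 h3]
        split_ifs
        · rw [hsm, bqb x hx h1, smul_zero]
        · exact hz _
      rw [f3 i j k (by omega) (by omega) (by omega) hi hj hk,
        f3 j k i (by omega) (by omega) (by omega) hj hk hi,
        f3 k i j (by omega) (by omega) (by omega) hk hi hj]
      simp

end Bracket

namespace LieTable

variable {a b : ℕ} (T : LieTable a b)

instance : AddCommGroup T.Alg := inferInstanceAs (AddCommGroup (Coord a b))

instance : Module ℂ T.Alg := inferInstanceAs (Module ℂ (Coord a b))

instance : LieRing T.Alg where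
  bracket u v := tableBracket T.t u v
  add_lie u v w := tableBracket_add_left T.t u v w
  lie_add u v w := tableBracket_add_right T.t u v w
  lie_self u := tableBracket_self T.t u
  leibniz_lie u v w :=
     leibniz_of_jacobi T.t u v w (T.jacobi u v w)

instance : LieAlgebra ℂ T.Alg where
  lie_smul c u v := tableBracket_smul_right T.t c u v

end LieTable

/-! The algebras. A basis vector `x` outside the nilradical is `e 0`. -/

/-- `𝔰¹_{n,1}(β)`, with basis `x = e 0, e 1, …, e n`:
`[e_i, e_1] = e_{i+1}` for `2 ≤ i ≤ n - 1`, `[e_1, x] = e_1`,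
`[e_i, x] = (i - 2 + β) e_i` for `2 ≤ i ≤ n`. -/
def s1 (n : ℕ) (β : ℂ) : LieTable 0 n where
  t i j :=
    (if 2 ≤ i ∧ i ≤ n - 1 ∧ j = 1 then e (i + 1) else 0)
    + (if i = 1 ∧ j = 0 then e 1 else 0)
    + (if 2 ≤ i ∧ i ≤ n ∧ j = 0 then ((i : ℂ) - 2 + β) • e i else 0)
  jacobi := by
    refine jacobi_of_gen _ (n - 1) 0 0 (fun i => (i : ℂ) - 2 + β) ?_ ?_ ?_ ?_ (Or.inl rfl) ?_ ?_
    · intro i j hi hj hij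
      simp only [Finset.mem_Icc] at hi hj
      simp only [genTable]
      split_ifs <;> first | omega | simp
    · omega
    · omega
    · omega
    · intro i _ _; push_cast; ring
    · intro i j _ _ _; omega

/-- `τ¹_{2m,1}(α)`, with basis `x = e 0, e 1, …, e (2m)`:
`[e_i, e_1] = e_{i+1}` for `2 ≤ i ≤ 2m - 2`, `[e_i, e_{2m+1-i}] = (-1)^i e_{2m}` for `2 ≤ i ≤ m`,
`[e_1, x] = e_1`, `[e_i, x] = (i - 2 + α) e_i` for `2 ≤ i ≤ 2m - 1`,
`[e_{2m}, x] = (2m - 3 + 2α) e_{2m}`. -/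
def tau1 (m : ℕ) (α : ℂ) : LieTable 0 (2 * m) where
  t i j :=
    (if 2 ≤ i ∧ i ≤ 2 * m - 2 ∧ j = 1 then e (i + 1) else 0)
    + (if 2 ≤ i ∧ i ≤ m ∧ j = 2 * m + 1 - i then (-1 : ℂ) ^ i • e (2 * m) else 0)
    + (if i = 1 ∧ j = 0 then e 1 else 0)
    + (if 2 ≤ i ∧ i ≤ 2 * m - 1 ∧ j = 0 then ((i : ℂ) - 2 + α) • e i else 0)
    + (if i = 2 * m ∧ j = 0 then (2 * (m : ℂ) - 3 + 2 * α) • e (2 * m) else 0)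
  jacobi := by
    refine jacobi_of_gen _ (2 * m - 2) (2 * m + 1) 0
      (fun i => if i = 2 * m then 2 * (m : ℂ) - 3 + 2 * α else (i : ℂ) - 2 + α)
      ?_ ?_ ?_ ?_ (Or.inr ⟨m, rfl⟩) ?_ ?_
    · intro i j hi hj hij
      simp only [Finset.mem_Icc] at hi hj
      simp only [genTable]
      by_cases him : i = 2 * m
      · subst him
        split_ifs <;> first | omega | simp
      · split_ifs <;> first | omega | simp
    · omega
    · omega
    · omega
    · intro i h1 h2
      rw [if_neg (by omega), if_neg (by omega)]; push_cast; ring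
    · intro i j h1 h2 h3
      rw [if_neg (show ¬ i = 2 * m by omega), if_neg (show ¬ j = 2 * m by omega), if_pos rfl]
      have h4 : (j : ℂ) = 2 * (m : ℂ) + 1 - i := by
        rw [eq_sub_iff_add_eq, add_comm]; exact_mod_cast h3
      rw [h4]; ring

/-- `τ²_{2m,1}`, with basis `x = e 0, e 1, …, e (2m)`:
`[e_i, e_1] = e_{i+1}` for `2 ≤ i ≤ 2m - 2`, `[e_i, e_{2m+1-i}] = (-1)^i e_{2m}` for `2 ≤ i ≤ m`,
`[e_1, x] = e_1 + e_{2m}`, `[e_i, x] = (i - m) e_i` for `2 ≤ i ≤ 2m - 1`,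
`[e_{2m}, x] = e_{2m}`. -/
def tau2 (m : ℕ) : LieTable 0 (2 * m) where
  t i j :=
    (if 2 ≤ i ∧ i ≤ 2 * m - 2 ∧ j = 1 then e (i + 1) else 0)
    + (if 2 ≤ i ∧ i ≤ m ∧ j = 2 * m + 1 - i then (-1 : ℂ) ^ i • e (2 * m) else 0)
    + (if i = 1 ∧ j = 0 then e 1 + e (2 * m) else 0)
    + (if 2 ≤ i ∧ i ≤ 2 * m - 1 ∧ j = 0 then ((i : ℂ) - m) • e i else 0)
    + (if i = 2 * m ∧ j = 0 then e (2 * m) else 0)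
  jacobi := by
    refine jacobi_of_gen _ (2 * m - 2) (2 * m + 1) 1
      (fun i => if i = 2 * m then 1 else (i : ℂ) - m)
      ?_ ?_ ?_ ?_ (Or.inr ⟨m, rfl⟩) ?_ ?_
    · intro i j hi hj hij
      simp only [Finset.mem_Icc] at hi hj
      simp only [genTable]
      by_cases him : i = 2 * m
      · subst him
        split_ifs <;> first | omega | simp
      · split_ifs <;> first | omega | simp
    · omega
    · omega
    · omega
    · intro i h1 h2
      rw [if_neg (by omega), if_neg (by omega)]; push_cast; ring
    · intro i j h1 h2 h3
      rw [if_neg (show ¬ i = 2 * m by omega), if_neg (show ¬ j = 2 * m by omega), if_pos rfl]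
      have h4 : (j : ℂ) = 2 * (m : ℂ) + 1 - i := by
        rw [eq_sub_iff_add_eq, add_comm]; exact_mod_cast h3
      rw [h4]; ring

/-- The nilpotent algebra `L_k`, with basis `e 1, …, e (n+1)`:
`[e_i, e_1] = e_{i+1}` for `2 ≤ i ≤ n`, `[e_i, e_{2k+1-i}] = (-1)^i e_{n+1}` for `2 ≤ i ≤ k`. -/
def nilL (n k : ℕ) (hk : k ≤ n / 2) : LieTable 1 (n + 1) where
  t i j :=
    (if 2 ≤ i ∧ i ≤ n ∧ j = 1 then e (i + 1) else 0)
    + (if 2 ≤ i ∧ i ≤ k ∧ j = 2 * k + 1 - i then (-1 : ℂ) ^ i • e (n + 1) else 0)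
  jacobi := by
    refine jacobi_of_gen _ n (2 * k + 1) 0 (fun i => (n : ℂ) + i - 2 * k)
      ?_ ?_ ?_ ?_ (Or.inr ⟨k, rfl⟩) ?_ ?_
    · intro i j hi hj hij
      simp only [Finset.mem_Icc] at hi hj
      simp only [genTable]
      split_ifs <;> first | omega | simp
    · omega
    · omega
    · omega
    · intro i _ _; push_cast; ring
    · intro i j h1 h2 h3
      have h4 : (j : ℂ) = 2 * (k : ℂ) + 1 - i := by
        rw [eq_sub_iff_add_eq, add_comm]; exact_mod_cast h3
      simp only [h4]; push_cast; ring

/-- The solvable algebra `L̃_k`, with basis `x = e 0, e 1, …, e (n+1)`: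
`[e_i, e_1] = e_{i+1}` for `2 ≤ i ≤ n`, `[e_i, e_{2k+1-i}] = (-1)^i e_{n+1}` for `2 ≤ i ≤ k`,
`[e_1, x] = e_1`, `[e_i, x] = (n + i - 2k) e_i` for `2 ≤ i ≤ n + 1`. -/
def solvL (n k : ℕ) (hk : k ≤ n / 2) : LieTable 0 (n + 1) where
  t i j :=
    (if 2 ≤ i ∧ i ≤ n ∧ j = 1 then e (i + 1) else 0)
    + (if 2 ≤ i ∧ i ≤ k ∧ j = 2 * k + 1 - i then (-1 : ℂ) ^ i • e (n + 1) else 0)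
    + (if i = 1 ∧ j = 0 then e 1 else 0)
    + (if 2 ≤ i ∧ i ≤ n + 1 ∧ j = 0 then ((n : ℂ) + i - 2 * k) • e i else 0)
  jacobi := by
    refine jacobi_of_gen _ n (2 * k + 1) 0 (fun i => (n : ℂ) + i - 2 * k)
      ?_ ?_ ?_ ?_ (Or.inr ⟨k, rfl⟩) ?_ ?_
    · intro i j hi hj hij
      simp only [Finset.mem_Icc] at hi hj
      simp only [genTable]
      split_ifs <;> first | omega | simp
    · omega
    · omega
    · omega
    · intro i _ _; push_cast; ring
    · intro i j h1 h2 h3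
      have h4 : (j : ℂ) = 2 * (k : ℂ) + 1 - i := by
        rw [eq_sub_iff_add_eq, add_comm]; exact_mod_cast h3
      simp only [h4]; push_cast; ring

/-- The nilradical: the largest nilpotent ideal, as the sum of all ideals that are nilpotent as
Lie algebras. (`LieAlgebra.maxNilpotentIdeal` is a different, smaller ideal: it is the largest
ideal on which the whole algebra acts nilpotently.) -/
def nilradical (L : Type*) [LieRing L] [LieAlgebra ℂ L] : LieIdeal ℂ L :=
  sSup {I : LieIdeal ℂ L | LieRing.IsNilpotent I}

/-- A short exact sequence `0 → V → E → L → 0` of complex Lie algebras is a non-split extension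
(in the sense of the extension method for solvable Lie algebras) if the nilradical `Ñ` of `E` is
the central extension by `V` of the nilradical `N` of `L` (so `Ñ` is the preimage of `N`, and `V`
is central in `Ñ`), and the centre of `Ñ` is not larger than `V`. -/
structure IsNonsplitExtension {V E L : Type*} [LieRing V] [LieAlgebra ℂ V] [LieRing E]
    [LieAlgebra ℂ E] [LieRing L] [LieAlgebra ℂ L] (i : V →ₗ⁅ℂ⁆ E) (p : E →ₗ⁅ℂ⁆ L) : Prop where
  isExtension : LieAlgebra.IsExtension i p
  nilradical_eq : nilradical E = LieIdeal.comap p (nilradical L)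
  center_eq : ∀ y : E,
    (y ∈ nilradical E ∧
      ∀ z ∈ nilradical E, ⁅y, z⁆ = 0) ↔ y ∈ i.range

end FiliformExt

end

/-! Write `v` for a generator of `V` and lift the basis of the quotient to `E`, defining the lift of
each `e_{i+1}` as the product of the lifts of `e_i` and `e_1`. Since `v` is central in the
nilradical and `V` is an ideal, the unknown data are few: `[v, x] = μ v`, `[e_n, e_1] = a v`, `[e_i,
e_j] = ω i j v` for `i, j ≥ 2`, and the defects `r`, `q` of `[e_1, x]` and `[e_2, x]`. The other
products with `x` follow from the Jacobi identity. This is `AdaptedBasis`. If `a = 0` and `ω 2 n =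
0`, then `e_n` would be central in the nilradical, so the condition on the centre gives `a ≠ 0` or
`ω 2 n ≠ 0`.

The Jacobi identity with `e_1` makes `ω` alternate in sign along each antidiagonal `i + j = const`.
Skew-symmetry kills the even antidiagonals, and centrality of `[e_n, e_1]` in the nilradical kills
those with `i + j > n + 2` (`IsFiliformCocycle`). The Jacobi identity with `x` is a weight count: `ω
i j ≠ 0` forces `μ = i + j - 4 + 2β`, so at most one antidiagonal `i + j = 2k + 1` survives, and `a
≠ 0` forces `μ = n - 1 + β`.

Three cases remain. If `ω = 0`, the result is `𝔰¹`. If `2k + 1 = n + 2`, it is `τ¹`, or `τ²` when `μ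
= 1` and the defect of `[e_1, x]` cannot be removed. If `2k + 1 < n + 2`, then `ω 2 n = 0`, hence `a
≠ 0`, and comparing the two values of `μ` gives `β = n + 2 - 2k` and `L̃_k`. In each case a
triangular change of basis (`newGen`) removes the defects and rescales the constants; an algebra
with a basis satisfying the relations of a table is the algebra of that table
(`HasNormalForm.nonempty_equiv`).

The nilradical of an algebra in normal form is the span of all basis vectors except `x`, by Engel's
theorem in one direction and the eigenvalue of `x` on `e_1` in the other. For `L̃_k` this span has
the table of `L_k`. -/

noncomputable section

namespace FiliformExt

/-! ### Coordinates, and linear maps given on the basis. -/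

section Coefficients

variable {a b : ℕ}

/-- The coefficient of `e k` in a coordinate vector. -/
def coeff (k : ℕ) : Coord a b →ₗ[ℂ] ℂ :=
  if h : k ∈ Finset.Icc a b then LinearMap.proj ⟨k, h⟩ else 0

theorem coeff_coe (u : Coord a b) (i : ↥(Finset.Icc a b)) : coeff (i : ℕ) u = u i := by
  simp [coeff]

/-- Membership is needed only for `k`: for `k` outside the range `coeff k` is the zero map, while
for `j` outside it both sides vanish. -/
theorem coeff_e {k : ℕ} (hk : k ∈ Finset.Icc a b) (j : ℕ) :
    coeff k (e j : Coord a b) = if k = j then 1 else 0 :=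
  coeff_coe (e j) ⟨k, hk⟩

theorem coeff_ext {u v : Coord a b} (h : ∀ k ∈ Finset.Icc a b, coeff k u = coeff k v) :
    u = v := by
  funext i
  rw [← coeff_coe u, ← coeff_coe v, h i i.2]

theorem eq_sum_coeff (u : Coord a b) : u = ∑ k ∈ Finset.Icc a b, coeff k u • e k := by
  refine coeff_ext fun k hk => ?_
  simp only [map_sum, map_smul, coeff_e hk, smul_eq_mul, mul_ite, mul_one, mul_zero]
  rw [Finset.sum_ite_eq, if_pos hk]

theorem tableBracket_eq_sum (t : ℕ → ℕ → Coord a b) (u v : Coord a b) :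
    tableBracket t u v = ∑ i ∈ Finset.Icc a b, ∑ j ∈ Finset.Icc a b,
      (coeff i u * coeff j v) • (t i j - t j i) := by
  unfold tableBracket
  rw [← Finset.sum_coe_sort (s := Finset.Icc a b) (f := fun i => ∑ j ∈ Finset.Icc a b,
    (coeff i u * coeff j v) • (t i j - t j i))]
  refine Finset.sum_congr rfl fun i _ => ?_
  rw [← Finset.sum_coe_sort (s := Finset.Icc a b)
    (f := fun j => (coeff (i : ℕ) u * coeff j v) • (t i j - t j i))]
  exact Finset.sum_congr rfl fun j _ => by rw [coeff_coe, coeff_coe]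

/-- The linear map that sends `e k` to `g k`. -/
def ofBasis {E : Type*} [AddCommGroup E] [Module ℂ E] (g : ℕ → E) : Coord a b →ₗ[ℂ] E :=
  ∑ k ∈ Finset.Icc a b, (coeff k).smulRight (g k)

variable {E : Type*} [AddCommGroup E] [Module ℂ E] (g : ℕ → E)

theorem ofBasis_apply (u : Coord a b) :
    ofBasis g u = ∑ k ∈ Finset.Icc a b, coeff k u • g k := by
  simp [ofBasis]

theorem ofBasis_e {k : ℕ} (hk : k ∈ Finset.Icc a b) : ofBasis g (e k : Coord a b) = g k := by
  rw [ofBasis_apply, Finset.sum_eq_single_of_mem k hk, coeff_e hk, if_pos rfl, one_smul]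
  intro j hj hjk
  rw [coeff_e hj, if_neg hjk, zero_smul]

end Coefficients

/-! ### Tables in normal form, and recognition of an algebra by its relations. -/

namespace LieTable

variable {a b : ℕ} (T : LieTable a b)

/-- The coordinates of an element of the algebra. -/
def toCoord : T.Alg ≃ₗ[ℂ] Coord a b := LinearEquiv.refl ℂ (Coord a b)

theorem toCoord_lie (u v : T.Alg) :
    T.toCoord ⁅u, v⁆ = tableBracket T.t (T.toCoord u) (T.toCoord v) := rfl

/-- The basis vectors of the algebra. -/
def gen (k : ℕ) : T.Alg := T.toCoord.symm (e k)

theorem toCoord_gen (k : ℕ) : T.toCoord (T.gen k) = e k := rfl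

theorem eq_sum_gen (u : T.Alg) :
    u = ∑ k ∈ Finset.Icc a b, coeff k (T.toCoord u) • T.gen k := by
  apply T.toCoord.injective
  simp only [map_sum, map_smul, toCoord_gen]
  exact eq_sum_coeff _

theorem coeff_lie (k : ℕ) (u v : T.Alg) :
    coeff k (T.toCoord ⁅u, v⁆) = ∑ i ∈ Finset.Icc a b, ∑ j ∈ Finset.Icc a b,
      coeff i (T.toCoord u) * coeff j (T.toCoord v) * coeff k (T.t i j - T.t j i) := by
  rw [toCoord_lie, tableBracket_eq_sum]
  simp only [map_sum, map_smul, smul_eq_mul]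

theorem lie_gen {i j : ℕ} (hi : i ∈ Finset.Icc a b) (hj : j ∈ Finset.Icc a b) :
    ⁅T.gen i, T.gen j⁆ = T.toCoord.symm (T.t i j - T.t j i) :=
  tableBracket_e T.t i j hi hj

/-- The products of distinct basis vectors are those of `genTable`. -/
def HasNormalForm (r s : ℕ) (ε : ℂ) (w : ℕ → ℂ) : Prop :=
  ∀ i j, i ∈ Finset.Icc a b → j ∈ Finset.Icc a b → i ≠ j → T.t i j = genTable r s ε w i j

/-- The relations of a table in normal form, for vectors of a Lie algebra. -/
structure Relations {E : Type*} [LieRing E] [LieAlgebra ℂ E] (a b r s : ℕ) (ε : ℂ) (w : ℕ → ℂ)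
    (g : ℕ → E) : Prop where
  lie_one : ∀ i, 2 ≤ i → i ≤ b → ⁅g i, g 1⁆ = if i ≤ r then g (i + 1) else 0
  lie_pair : ∀ i j, 2 ≤ i → i < j → j ≤ b →
    ⁅g i, g j⁆ = if i + j = s then (-1 : ℂ) ^ i • g b else 0
  one_lie_zero : a = 0 → ⁅g 1, g 0⁆ = g 1 + ε • g b
  lie_zero : a = 0 → ∀ i, 2 ≤ i → i ≤ b → ⁅g i, g 0⁆ = w i • g i

variable {T}

theorem HasNormalForm.lie_gen_one {r s : ℕ} {ε : ℂ} {w : ℕ → ℂ} (hT : T.HasNormalForm r s ε w)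
    (ha : a ≤ 1) {i : ℕ} (hi : 2 ≤ i) (hib : i ≤ b) :
    ⁅T.gen i, T.gen 1⁆ = if i ≤ r then T.gen (i + 1) else 0 := by
  have h1 : i ∈ Finset.Icc a b := Finset.mem_Icc.mpr ⟨by omega, by omega⟩
  have h2 : 1 ∈ Finset.Icc a b := Finset.mem_Icc.mpr ⟨by omega, by omega⟩
  rw [T.lie_gen h1 h2, hT i 1 h1 h2 (by omega), hT 1 i h2 h1 (by omega), genTable_one _ _ _ _ _ hi,
    genTable_one_left _ _ _ _ _ hi, sub_zero]
  split_ifs <;> simp [gen]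

theorem HasNormalForm.lie_gen_pair {r s : ℕ} {ε : ℂ} {w : ℕ → ℂ} (hT : T.HasNormalForm r s ε w)
    (ha : a ≤ 1) {i j : ℕ} (hi : 2 ≤ i) (hij : i < j) (hjb : j ≤ b) :
    ⁅T.gen i, T.gen j⁆ = if i + j = s then (-1 : ℂ) ^ i • T.gen b else 0 := by
  have h1 : i ∈ Finset.Icc a b := Finset.mem_Icc.mpr ⟨by omega, by omega⟩
  have h2 : j ∈ Finset.Icc a b := Finset.mem_Icc.mpr ⟨by omega, by omega⟩
  rw [T.lie_gen h1 h2, hT i j h1 h2 (by omega), hT j i h2 h1 (by omega),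
    genTable_pair _ _ _ _ _ _ hi (by omega), genTable_pair _ _ _ _ _ _ (by omega) hi,
    if_neg (show ¬ (j < i ∧ j + i = s) by omega), sub_zero]
  simp only [hij, true_and]
  split_ifs <;> simp [gen]

theorem HasNormalForm.lie_gen_zero {T : LieTable 0 b} {r s : ℕ} {ε : ℂ} {w : ℕ → ℂ}
    (hT : T.HasNormalForm r s ε w) {i : ℕ} (hi : 2 ≤ i) (hib : i ≤ b) :
    ⁅T.gen i, T.gen 0⁆ = w i • T.gen i := by
  have h1 : i ∈ Finset.Icc 0 b := Finset.mem_Icc.mpr ⟨by omega, by omega⟩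
  have h2 : 0 ∈ Finset.Icc 0 b := Finset.mem_Icc.mpr ⟨by omega, by omega⟩
  rw [T.lie_gen h1 h2, hT i 0 h1 h2 (by omega), hT 0 i h2 h1 (by omega),
    genTable_zero _ _ _ _ _ hi, genTable_zero_left, sub_zero]
  simp [gen]

theorem HasNormalForm.lie_gen_one_zero {T : LieTable 0 b} {r s : ℕ} {ε : ℂ} {w : ℕ → ℂ}
    (hT : T.HasNormalForm r s ε w) (hb : 1 ≤ b) :
    ⁅T.gen 1, T.gen 0⁆ = T.gen 1 + ε • T.gen b := by
  have h1 : 1 ∈ Finset.Icc 0 b := Finset.mem_Icc.mpr ⟨by omega, by omega⟩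
  have h2 : 0 ∈ Finset.Icc 0 b := Finset.mem_Icc.mpr ⟨by omega, by omega⟩
  rw [T.lie_gen h1 h2, hT 1 0 h1 h2 (by omega), hT 0 1 h2 h1 (by omega), genTable_zero_left,
    sub_zero]
  simp [genTable, gen]

theorem HasNormalForm.relations_gen {r s : ℕ} {ε : ℂ} {w : ℕ → ℂ} (hT : T.HasNormalForm r s ε w)
    (ha : a ≤ 1) (hb : 1 ≤ b) : Relations a b r s ε w T.gen where
  lie_one _ hi hib := hT.lie_gen_one ha hi hib
  lie_pair _ _ hi hij hjb := hT.lie_gen_pair ha hi hij hjb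
  one_lie_zero h := by subst h; exact hT.lie_gen_one_zero hb
  lie_zero h _ hi hib := by subst h; exact hT.lie_gen_zero hi hib

/-- A Lie algebra with a basis that satisfies the relations of a table is the algebra of that
table. -/
theorem HasNormalForm.nonempty_equiv {r s : ℕ} {ε : ℂ} {w : ℕ → ℂ} (hT : T.HasNormalForm r s ε w)
    (ha : a ≤ 1) (hb : 1 ≤ b) {E : Type*} [LieRing E] [LieAlgebra ℂ E] {g : ℕ → E}
    (hg : Relations a b r s ε w g)
    (hbij : Function.Bijective (ofBasis g : Coord a b →ₗ[ℂ] E)) (hr : 2 ≤ b → r < b) :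
    Nonempty (E ≃ₗ⁅ℂ⁆ T.Alg) := by
  have hTg := hT.relations_gen ha hb
  let f : T.Alg →ₗ[ℂ] E := (ofBasis g : Coord a b →ₗ[ℂ] E) ∘ₗ T.toCoord.toLinearMap
  have hf : ∀ k, k ∈ Finset.Icc a b → f (T.gen k) = g k := fun k hk => ofBasis_e g hk
  have hmem : ∀ k, 1 ≤ k → k ≤ b → k ∈ Finset.Icc a b := fun k h1 h2 =>
    Finset.mem_Icc.mpr ⟨by omega, h2⟩
  -- Products with `e 1` and `e 0` are listed with the larger index on the left, so this order is
  -- checked first; the opposite order and the diagonal follow by skew-symmetry.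
  have hlt : ∀ i j, i ∈ Finset.Icc a b → j ∈ Finset.Icc a b → i < j →
      f ⁅T.gen j, T.gen i⁆ = ⁅g j, g i⁆ := by
    intro i j hi hj hij
    have hi2 := Finset.mem_Icc.mp hi
    have hj2 := Finset.mem_Icc.mp hj
    by_cases hi0 : i = 0
    · subst hi0
      have ha0 : a = 0 := by omega
      by_cases hj1 : j = 1
      · subst hj1
        rw [hTg.one_lie_zero ha0, hg.one_lie_zero ha0, map_add, map_smul, hf _ hj,
          hf b (hmem b hb le_rfl)]
      · rw [hTg.lie_zero ha0 j (by omega) hj2.2, hg.lie_zero ha0 j (by omega) hj2.2, map_smul,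
          hf _ hj]
    · by_cases hi1 : i = 1
      · subst hi1
        rw [hTg.lie_one j (by omega) hj2.2, hg.lie_one j (by omega) hj2.2]
        split_ifs with h
        -- `r < b` keeps `e (j + 1)` among the basis vectors.
        · exact hf _ (hmem _ (by omega) (by have := hr (by omega); omega))
        · exact map_zero f
      · rw [← lie_skew (T.gen j), ← lie_skew (g j), map_neg, hTg.lie_pair i j (by omega) hij hj2.2,
          hg.lie_pair i j (by omega) hij hj2.2]
        split_ifs
        · rw [map_smul, hf b (hmem b hb le_rfl)]
        · rw [map_zero]
  have hgen : ∀ i j, i ∈ Finset.Icc a b → j ∈ Finset.Icc a b →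
      f ⁅T.gen i, T.gen j⁆ = ⁅g i, g j⁆ := by
    intro i j hi hj
    rcases lt_trichotomy i j with hij | hij | hij
    · rw [← lie_skew (T.gen i), ← lie_skew (g i), map_neg, hlt i j hi hj hij]
    · subst hij
      rw [lie_self, lie_self, map_zero]
    · exact hlt j i hj hi hij
  have hlie : ∀ u v : T.Alg, f ⁅u, v⁆ = ⁅f u, f v⁆ := by
    intro u v
    rw [T.eq_sum_gen u, T.eq_sum_gen v]
    rw [map_sum f, map_sum f, sum_lie_sum, sum_lie_sum, map_sum f]
    refine Finset.sum_congr rfl fun i hi => ?_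
    rw [map_sum f]
    refine Finset.sum_congr rfl fun j hj => ?_
    simp only [smul_lie, lie_smul, map_smul, hgen _ _ hi hj, hf _ hi, hf _ hj]
  have hfbij : Function.Bijective f := hbij.comp T.toCoord.bijective
  let F : T.Alg →ₗ⁅ℂ⁆ E := { f with map_lie' := fun {u v} => hlie u v }
  exact ⟨(LieEquiv.ofBijective F hfbij).symm⟩

end LieTable

end FiliformExt

end

noncomputable section

namespace FiliformExt

theorem coe_lie_lieIdeal {L : Type*} [LieRing L] [LieAlgebra ℂ L] (I : LieIdeal ℂ L) (x y : I) :
    ((⁅x, y⁆ : I) : L) = ⁅(x : L), (y : L)⁆ := rfl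

namespace LieTable

/-! The nilradical of an algebra in normal form. -/

variable {b : ℕ} {T : LieTable 0 b} {r s : ℕ} {ε : ℂ} {w : ℕ → ℂ}

theorem HasNormalForm.coeff_zero_lie (hT : T.HasNormalForm r s ε w) (hb : 2 ≤ b) (u v : T.Alg) :
    coeff 0 (T.toCoord ⁅u, v⁆) = 0 := by
  rw [coeff_lie]
  refine Finset.sum_eq_zero fun i hi => Finset.sum_eq_zero fun j hj => ?_
  have h0 : (0 : ℕ) ∈ Finset.Icc 0 b := by simp
  have key : ∀ i j, coeff 0 (genTable r s ε w i j : Coord 0 b) = 0 := by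
    intro i j
    simp only [genTable, map_add, apply_ite (coeff 0), map_smul, map_zero, coeff_e h0]
    split_ifs <;> first | contradiction | omega | simp
  by_cases hij : i = j
  · simp [hij]
  · rw [hT i j hi hj hij, hT j i hj hi (Ne.symm hij), map_sub, key, key]
    simp

theorem HasNormalForm.coeff_one_lie (hT : T.HasNormalForm r s ε w) (hb : 2 ≤ b) (u v : T.Alg) :
    coeff 1 (T.toCoord ⁅u, v⁆) = coeff 1 (T.toCoord u) * coeff 0 (T.toCoord v)
      - coeff 0 (T.toCoord u) * coeff 1 (T.toCoord v) := by
  have h0 : (0 : ℕ) ∈ Finset.Icc 0 b := by simp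
  have h1 : (1 : ℕ) ∈ Finset.Icc 0 b := Finset.mem_Icc.mpr ⟨by omega, by omega⟩
  have key : ∀ i j, coeff 1 (genTable r s ε w i j : Coord 0 b)
      = if i = 1 ∧ j = 0 then 1 else 0 := by
    intro i j
    simp only [genTable, map_add, apply_ite (coeff 1), map_smul, map_zero, coeff_e h1]
    split_ifs <;> first | omega | simp
  have hc : ∀ i ∈ Finset.Icc 0 b, ∀ j ∈ Finset.Icc 0 b,
      coeff 1 (T.t i j - T.t j i)
        = (if j = 0 then (if i = 1 then 1 else 0) else 0)
          - (if j = 1 then (if i = 0 then 1 else 0) else 0) := by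
    intro i hi j hj
    by_cases hij : i = j
    · subst hij
      split_ifs <;> first | omega | simp
    · rw [hT i j hi hj hij, hT j i hj hi (Ne.symm hij), map_sub, key, key]
      split_ifs <;> first | omega | simp
  rw [coeff_lie]
  have : ∀ i ∈ Finset.Icc 0 b, ∑ j ∈ Finset.Icc 0 b,
      coeff i (T.toCoord u) * coeff j (T.toCoord v) * coeff 1 (T.t i j - T.t j i)
      = (if i = 1 then coeff i (T.toCoord u) * coeff 0 (T.toCoord v) else 0)
        - (if i = 0 then coeff i (T.toCoord u) * coeff 1 (T.toCoord v) else 0) := by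
    intro i hi
    rw [Finset.sum_congr rfl fun j hj => by rw [hc i hi j hj]]
    simp only [mul_sub, mul_ite, mul_one, mul_zero, Finset.sum_sub_distrib, Finset.sum_ite_eq',
      h0, h1, if_true]
  rw [Finset.sum_congr rfl this, Finset.sum_sub_distrib, Finset.sum_ite_eq', Finset.sum_ite_eq',
    if_pos h0, if_pos h1]

/-- The ideal spanned by the basis vectors other than `e 0`. -/
def HasNormalForm.ideal (hT : T.HasNormalForm r s ε w) (hb : 2 ≤ b) : LieIdeal ℂ T.Alg where
  carrier := {u | coeff 0 (T.toCoord u) = 0}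
  add_mem' {u v} hu hv := by
    simp only [Set.mem_ofPred_eq] at hu hv ⊢
    rw [map_add, map_add, hu, hv, add_zero]
  zero_mem' := by simp
  smul_mem' c u hu := by
    simp only [Set.mem_ofPred_eq] at hu ⊢
    rw [map_smul, map_smul, hu, smul_zero]
  lie_mem {u v} _ := hT.coeff_zero_lie hb u v

theorem HasNormalForm.mem_ideal (hT : T.HasNormalForm r s ε w) (hb : 2 ≤ b) (u : T.Alg) :
    u ∈ hT.ideal hb ↔ coeff 0 (T.toCoord u) = 0 := Iff.rfl

/-- Away from `e 0`, a product of basis vectors lies in a strictly higher index than both factors: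
this is clear for `e (i + 1)`, and for `e b` it holds because `i + j = s ≤ b + 1` with `i, j ≥ 2`
gives `i, j < b`. -/
theorem HasNormalForm.coeff_lie_eq_zero (hT : T.HasNormalForm r s ε w) (hs : s ≤ b + 1)
    {u v : T.Alg} {l : ℕ} (hu0 : coeff 0 (T.toCoord u) = 0) (hv0 : coeff 0 (T.toCoord v) = 0)
    (hv : ∀ k < l, coeff k (T.toCoord v) = 0) :
    ∀ k < l + 1, coeff k (T.toCoord ⁅u, v⁆) = 0 := by
  intro k hk
  by_cases hkb : k ∈ Finset.Icc 0 b
  swap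
  · simp [coeff, hkb]
  rw [coeff_lie]
  refine Finset.sum_eq_zero fun i hi => Finset.sum_eq_zero fun j hj => ?_
  have key : ∀ i j, 1 ≤ i → 1 ≤ j → i ≤ b → j ≤ b → i ≠ j → k ≤ i ∨ k ≤ j →
      coeff k (genTable r s ε w i j : Coord 0 b) = 0 := by
    intro i j h1 h2 h3 h4 h5 h6
    simp only [genTable, map_add, apply_ite (coeff k), map_smul, map_zero, coeff_e hkb]
    split_ifs <;> first | omega | simp
  have hi2 := (Finset.mem_Icc.mp hi).2
  have hj2 := (Finset.mem_Icc.mp hj).2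
  by_cases hij : i = j
  · simp [hij]
  by_cases hi0 : i = 0
  · simp [hi0, hu0]
  by_cases hj0 : j = 0
  · simp [hj0, hv0]
  by_cases hjl : j < l
  · simp [hv j hjl]
  rw [hT i j hi hj hij, hT j i hj hi (Ne.symm hij), map_sub,
    key i j (by omega) (by omega) hi2 hj2 hij (by omega),
    key j i (by omega) (by omega) hj2 hi2 (Ne.symm hij) (by omega)]
  simp

instance : FiniteDimensional ℂ T.Alg := inferInstanceAs (FiniteDimensional ℂ (Coord 0 b))

/-- By Engel's theorem it is enough that each `ad u` be nilpotent on the ideal, and each application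
of `ad u` raises the lowest index by at least one. -/
theorem HasNormalForm.isNilpotent_ideal (hT : T.HasNormalForm r s ε w) (hb : 2 ≤ b)
    (hs : s ≤ b + 1) : LieRing.IsNilpotent (hT.ideal hb) := by
  rw [LieAlgebra.isNilpotent_iff_forall (R := ℂ)]
  intro u
  have key : ∀ (l : ℕ) (v : hT.ideal hb),
      ∀ k < l, coeff k (T.toCoord (((LieAlgebra.ad ℂ (hT.ideal hb) u ^ l) v :
        hT.ideal hb) : T.Alg)) = 0 := by
    intro l v
    induction l with
    | zero => intro k hk; omega
    | succ l ih =>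
      rw [pow_succ', Module.End.mul_apply, LieAlgebra.ad_apply, coe_lie_lieIdeal]
      exact hT.coeff_lie_eq_zero hs u.2 ((LieAlgebra.ad ℂ (hT.ideal hb) u ^ l) v).2 ih
  refine ⟨b + 1, LinearMap.ext fun v => Subtype.ext (T.toCoord.injective ?_)⟩
  refine coeff_ext fun k hk => ?_
  rw [key (b + 1) v k (by have := (Finset.mem_Icc.mp hk).2; omega)]
  simp

/-- If `u` in an ideal `I` has `e 0`-coefficient `c ≠ 0`, then `[e_1, u]` lies in `I` with nonzero
`e 1`-coefficient, and `ad u` multiplies that coefficient by `-c` each time, so `ad u` is not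
nilpotent on `I`. -/
theorem HasNormalForm.le_ideal (hT : T.HasNormalForm r s ε w) (hb : 2 ≤ b)
    (I : LieIdeal ℂ T.Alg) (hI : LieRing.IsNilpotent I) : I ≤ hT.ideal hb := by
  intro u hu
  rw [hT.mem_ideal hb]
  by_contra h0
  have h1 : (1 : ℕ) ∈ Finset.Icc 0 b := Finset.mem_Icc.mpr ⟨by omega, by omega⟩
  have h0b : (0 : ℕ) ∈ Finset.Icc 0 b := by simp
  obtain ⟨k, hk⟩ := LieAlgebra.nilpotent_ad_of_nilpotent_algebra ℂ I
  have hy : ⁅T.gen 1, u⁆ ∈ I := I.lie_mem hu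
  have key : ∀ l : ℕ, coeff 0 (T.toCoord
      (((LieAlgebra.ad ℂ I ⟨u, hu⟩ ^ l) ⟨_, hy⟩ : I) : T.Alg)) = 0 ∧ coeff 1 (T.toCoord
      (((LieAlgebra.ad ℂ I ⟨u, hu⟩ ^ l) ⟨_, hy⟩ : I) : T.Alg)) ≠ 0 := by
    intro l
    induction l with
    | zero =>
      rw [pow_zero, Module.End.one_apply]
      refine ⟨hT.coeff_zero_lie hb _ _, ?_⟩
      rw [hT.coeff_one_lie hb, toCoord_gen, coeff_e h1, coeff_e h0b]
      simpa using h0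
    | succ l ih =>
      rw [pow_succ', Module.End.mul_apply, LieAlgebra.ad_apply, coe_lie_lieIdeal]
      refine ⟨hT.coeff_zero_lie hb _ _, ?_⟩
      rw [hT.coeff_one_lie hb, ih.1, mul_zero, zero_sub]
      exact neg_ne_zero.mpr (mul_ne_zero h0 ih.2)
  refine (key k).2 ?_
  rw [hk]
  simp

theorem HasNormalForm.nilradical_eq (hT : T.HasNormalForm r s ε w) (hb : 2 ≤ b)
    (hs : s ≤ b + 1) : nilradical T.Alg = hT.ideal hb :=
  le_antisymm (sSup_le fun I hI => hT.le_ideal hb I hI)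
    (le_sSup (hT.isNilpotent_ideal hb hs))

theorem HasNormalForm.gen_mem_ideal (hT : T.HasNormalForm r s ε w) (hb : 2 ≤ b) {k : ℕ}
    (hk : 1 ≤ k) : T.gen k ∈ hT.ideal hb := by
  rw [hT.mem_ideal, toCoord_gen, coeff_e (by simp), if_neg (by omega)]

/-- The nilradical of a solvable algebra in normal form has the table with `e 0` removed. -/
theorem HasNormalForm.nonempty_nilradical_equiv {ε' : ℂ} {w' : ℕ → ℂ} {T' : LieTable 1 b}
    (hT : T.HasNormalForm r s ε w)
    (hT' : T'.HasNormalForm r s ε' w') (hb : 2 ≤ b) (hs : s ≤ b + 1) (hr : r < b) :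
    Nonempty (nilradical T.Alg ≃ₗ⁅ℂ⁆ T'.Alg) := by
  rw [hT.nilradical_eq hb hs]
  have hTg := hT.relations_gen (by omega) (by omega)
  let g : ℕ → hT.ideal hb := fun k =>
    if h : 1 ≤ k then ⟨T.gen k, hT.gen_mem_ideal hb h⟩ else 0
  have hg : ∀ k, 1 ≤ k → (g k : T.Alg) = T.gen k := fun k hk => by simp [g, hk]
  have hrel : Relations 1 b r s ε' w' g := by
    -- The clauses about `e 0` are vacuous since the basis starts at `1`; this is why `ε'` and `w'`
    -- are arbitrary.
    refine ⟨fun i hi hib => ?_, fun i j hi hij hjb => ?_, by omega, by omega⟩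
    · apply Subtype.ext
      rw [coe_lie_lieIdeal, hg i (by omega), hg 1 le_rfl, hTg.lie_one i hi hib]
      split_ifs
      · exact (hg _ (by omega)).symm
      · rfl
    · apply Subtype.ext
      rw [coe_lie_lieIdeal, hg i (by omega), hg j (by omega), hTg.lie_pair i j hi hij hjb]
      split_ifs
      · rw [← hg b (by omega)]; rfl
      · rfl
  refine hT'.nonempty_equiv le_rfl (by omega) hrel ?_ fun _ => hr
  have hval : ∀ u : Coord 1 b, ((ofBasis g u : hT.ideal hb) : T.Alg)
      = ∑ k ∈ Finset.Icc 1 b, coeff k u • T.gen k := by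
    intro u
    rw [ofBasis_apply, AddSubmonoidClass.coe_finsetSum]
    exact Finset.sum_congr rfl fun k hk => by
      rw [← hg k (Finset.mem_Icc.mp hk).1]; rfl
  constructor
  · rw [← LinearMap.ker_eq_bot, LinearMap.ker_eq_bot']
    intro u hu
    refine coeff_ext fun l hl => ?_
    have h := congrArg (fun y : hT.ideal hb => coeff l (T.toCoord (y : T.Alg))) hu
    have hl0 : l ∈ Finset.Icc 0 b := Finset.mem_Icc.mpr ⟨by omega, (Finset.mem_Icc.mp hl).2⟩
    simp only [hval, map_sum, map_smul, toCoord_gen, coeff_e hl0, smul_eq_mul, mul_ite, mul_one,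
      mul_zero, Finset.sum_ite_eq, if_pos hl] at h
    simpa using h
  · intro y
    have hsplit : ∀ f : ℕ → T.Alg, ∑ k ∈ Finset.Icc 0 b, f k = f 0 + ∑ k ∈ Finset.Icc 1 b, f k := by
      intro f
      have : Finset.Icc 0 b = insert 0 (Finset.Icc 1 b) := by
        ext k; simp only [Finset.mem_Icc, Finset.mem_insert]; omega
      rw [this, Finset.sum_insert (by simp)]
    refine ⟨∑ k ∈ Finset.Icc 1 b, coeff k (T.toCoord (y : T.Alg)) • e k, Subtype.ext ?_⟩
    rw [hval]
    conv_rhs => rw [T.eq_sum_gen (y : T.Alg), hsplit,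
      (hT.mem_ideal hb _).mp y.2, zero_smul, zero_add]
    refine Finset.sum_congr rfl fun l hl => ?_
    congr 1
    simp only [map_sum, map_smul, coeff_e hl, smul_eq_mul, mul_ite, mul_one,
      mul_zero, Finset.sum_ite_eq, if_pos hl]

end LieTable

/-! ### The algebras of the theorem in normal form. -/

open LieTable

/-- The value `s = 0` switches off the antidiagonal products, whose indices are at least `2`. -/
theorem s1_hasNormalForm (n : ℕ) (β : ℂ) :
    (s1 n β).HasNormalForm (n - 1) 0 0 (fun i => (i : ℂ) - 2 + β) := by
  intro i j hi hj hij
  simp only [Finset.mem_Icc] at hi hj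
  simp only [genTable, s1]
  split_ifs <;> first | omega | simp

theorem tau1_hasNormalForm (m : ℕ) (α : ℂ) :
    (tau1 m α).HasNormalForm (2 * m - 2) (2 * m + 1) 0
      (fun i => if i = 2 * m then 2 * (m : ℂ) - 3 + 2 * α else (i : ℂ) - 2 + α) := by
  intro i j hi hj hij
  simp only [Finset.mem_Icc] at hi hj
  simp only [genTable, tau1]
  by_cases him : i = 2 * m
  · subst him
    split_ifs <;> first | omega | simp
  · split_ifs <;> first | omega | simp

theorem tau2_hasNormalForm (m : ℕ) :
    (tau2 m).HasNormalForm (2 * m - 2) (2 * m + 1) 1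
      (fun i => if i = 2 * m then 1 else (i : ℂ) - m) := by
  intro i j hi hj hij
  simp only [Finset.mem_Icc] at hi hj
  simp only [genTable, tau2]
  by_cases him : i = 2 * m
  · subst him
    split_ifs <;> first | omega | simp
  · split_ifs <;> first | omega | simp

theorem nilL_hasNormalForm (n k : ℕ) (hk : k ≤ n / 2) :
    (nilL n k hk).HasNormalForm n (2 * k + 1) 0 (fun i => (n : ℂ) + i - 2 * k) := by
  intro i j hi hj hij
  simp only [Finset.mem_Icc] at hi hj
  simp only [genTable, nilL]
  split_ifs <;> first | omega | simp

theorem solvL_hasNormalForm (n k : ℕ) (hk : k ≤ n / 2) :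
    (solvL n k hk).HasNormalForm n (2 * k + 1) 0 (fun i => (n : ℂ) + i - 2 * k) := by
  intro i j hi hj hij
  simp only [Finset.mem_Icc] at hi hj
  simp only [genTable, solvL]
  split_ifs <;> first | omega | simp

theorem nonempty_nilradical_solvL_equiv (n k : ℕ) (hk : k ≤ n / 2) (hk2 : 2 ≤ k) :
    Nonempty (nilradical (solvL n k hk).Alg ≃ₗ⁅ℂ⁆ (nilL n k hk).Alg) :=
  (solvL_hasNormalForm n k hk).nonempty_nilradical_equiv (nilL_hasNormalForm n k hk)
    (by omega) (by omega) (by omega)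

end FiliformExt

end

noncomputable section

namespace FiliformExt

open LieTable

/-! ### Cocycles on the abelian ideal of the model filiform algebra. -/

section Cocycle

/-- The relations satisfied by the coefficients of a 2-cocycle of the model filiform algebra on
the abelian ideal spanned by `e 2, …, e n`. -/
structure IsFiliformCocycle (n : ℕ) (ω : ℕ → ℕ → ℂ) : Prop where
  swap : ∀ i j, 2 ≤ i → i ≤ n → 2 ≤ j → j ≤ n → ω i j = - ω j i
  succ : ∀ i j, 2 ≤ i → i < n → 2 ≤ j → j < n → ω (i + 1) j = - ω i (j + 1)
  last : ∀ i, 3 ≤ i → i ≤ n → ω i n = 0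

namespace IsFiliformCocycle

variable {n : ℕ} {ω : ℕ → ℕ → ℂ} (h : IsFiliformCocycle n ω)
include h

theorem shift (d : ℕ) : ∀ i j, 2 ≤ i → 2 ≤ j → i + d ≤ n → j + d ≤ n →
    ω (i + d) j = (-1) ^ d * ω i (j + d) := by
  induction d with
  | zero => intros; simp
  | succ d ih =>
    intro i j hi hj hin hjn
    rw [← add_assoc, h.succ (i + d) j (by omega) (by omega) hj (by omega),
      ih i (j + 1) hi (by omega) (by omega) (by omega), pow_succ,
      show j + (d + 1) = j + 1 + d by omega]
    ring

theorem eq_of_le {i j : ℕ} (hi : 2 ≤ i) (hin : i ≤ n) (hj : 2 ≤ j) (hij : i + j ≤ n + 2) :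
    ω i j = (-1) ^ i * ω 2 (i + j - 2) := by
  have := h.shift (i - 2) 2 j le_rfl hj (by omega) (by omega)
  rw [show 2 + (i - 2) = i by omega, show j + (i - 2) = i + j - 2 by omega] at this
  rw [this]
  congr 1
  conv_rhs => rw [show i = i - 2 + 2 by omega, pow_add]
  simp

/-- Sliding along the antidiagonal until the second index is `n` leaves the first at least `3`,
precisely because `i + j > n + 2`, and there `last` applies. -/
theorem eq_zero_of_lt {i j : ℕ} (hin : i ≤ n) (hj : 2 ≤ j) (hjn : j ≤ n)
    (hij : n + 2 < i + j) : ω i j = 0 := by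
  have := h.shift (n - j) (i - (n - j)) j (by omega) hj (by omega) (by omega)
  rw [show i - (n - j) + (n - j) = i by omega, show j + (n - j) = n by omega,
    h.last _ (by omega) (by omega), mul_zero] at this
  exact this

/-- An even antidiagonal meets the diagonal, where skew-symmetry gives zero. -/
theorem eq_zero_of_even_of_le {i j : ℕ} (hin : i ≤ n) (hj : 2 ≤ j) (hij : j ≤ i)
    (he : Even (i + j)) : ω i j = 0 := by
  obtain ⟨m, hm⟩ := he
  have hmm : ω m m = 0 := by
    have := h.swap m m (by omega) (by omega) (by omega) (by omega)
    exact self_eq_neg.mp this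
  have := h.shift (m - j) m j (by omega) hj (by omega) (by omega)
  rwa [show m + (m - j) = i by omega, show j + (m - j) = m by omega, hmm, mul_zero] at this

theorem eq_zero_of_even {i j : ℕ} (hi : 2 ≤ i) (hin : i ≤ n) (hj : 2 ≤ j) (hjn : j ≤ n)
    (he : Even (i + j)) : ω i j = 0 := by
  rcases le_total j i with hij | hij
  · exact h.eq_zero_of_even_of_le hin hj hij he
  · rw [h.swap i j hi hin hj hjn, h.eq_zero_of_even_of_le hjn hi hij (by rwa [add_comm]), neg_zero]

end IsFiliformCocycle

end Cocycle

/-- The Jacobi identity as a derivation rule for right multiplication, which suits tables where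
`e_1` and `x` act from the right. -/
theorem lie_lie_eq_add {E : Type*} [LieRing E] (x y z : E) : ⁅⁅x, y⁆, z⁆ = ⁅⁅x, z⁆, y⁆ + ⁅x, ⁅y, z⁆⁆ := by
  rw [lie_lie, ← lie_skew ⁅x, z⁆ y]
  abel

/-! ### Structure constants of an extension and the constraints on them. -/

section Adapted

variable {E : Type*} [LieRing E] [LieAlgebra ℂ E]

/-- Lifts `B 0, …, B n` of the basis of `𝔰¹_{n,1}(β)` to an extension by the line of `v`. -/
structure AdaptedBasis (n : ℕ) (β μ a r q : ℂ) (ω : ℕ → ℕ → ℂ) (B : ℕ → E) (v : E) : Prop where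
  ne_zero : v ≠ 0
  exists_eq : ∀ y, ∃ (c : ℕ → ℂ) (d : ℂ), y = ∑ k ∈ Finset.Icc 0 n, c k • B k + d • v
  finrank_eq : Module.finrank ℂ E = n + 2
  v_lie : ∀ i, 1 ≤ i → i ≤ n → ⁅v, B i⁆ = 0
  v_lie_zero : ⁅v, B 0⁆ = μ • v
  lie_one : ∀ i, 2 ≤ i → i < n → ⁅B i, B 1⁆ = B (i + 1)
  last_lie_one : ⁅B n, B 1⁆ = a • v
  lie_pair : ∀ i j, 2 ≤ i → i ≤ n → 2 ≤ j → j ≤ n → ⁅B i, B j⁆ = ω i j • v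
  one_lie_zero : ⁅B 1, B 0⁆ = B 1 + r • v
  lie_zero : ∀ i, 2 ≤ i → i ≤ n →
    ⁅B i, B 0⁆ = ((i : ℂ) - 2 + β) • B i + (if i = 2 then q else 0) • v

namespace AdaptedBasis

variable {n : ℕ} {β μ a r q : ℂ} {ω : ℕ → ℕ → ℂ} {B : ℕ → E} {v : E}

theorem lie_v (h : AdaptedBasis n β μ a r q ω B v) {i : ℕ} (hi : 1 ≤ i) (hin : i ≤ n) :
    ⁅B i, v⁆ = 0 := by
  rw [← lie_skew, h.v_lie i hi hin, neg_zero]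

theorem smul_v_inj (h : AdaptedBasis n β μ a r q ω B v) {x y : ℂ} (hxy : x • v = y • v) :
    x = y :=
  smul_left_injective ℂ h.ne_zero hxy

theorem isFiliformCocycle (h : AdaptedBasis n β μ a r q ω B v) :
    IsFiliformCocycle n ω where
  swap i j hi hin hj hjn := by
    apply h.smul_v_inj
    rw [neg_smul, ← h.lie_pair i j hi hin hj hjn, ← h.lie_pair j i hj hjn hi hin, lie_skew]
  succ i j hi hin hj hjn := by
    have := lie_lie_eq_add (B i) (B j) (B 1)
    rw [h.lie_pair i j hi hin.le hj hjn.le, h.lie_one i hi hin, h.lie_one j hj hjn,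
      smul_lie, h.v_lie 1 le_rfl (by omega), smul_zero,
      h.lie_pair (i + 1) j (by omega) hin hj hjn.le, h.lie_pair i (j + 1) hi hin.le (by omega) hjn,
      ← add_smul] at this
    have h0 := h.smul_v_inj ((zero_smul ℂ v).trans this)
    linear_combination -h0
  last i hi hin := by
    obtain ⟨j, rfl⟩ : ∃ j, i = j + 1 := ⟨i - 1, by omega⟩
    -- Here `[e_n, e_1] = a v` commutes with `e_j`, so only the term `ω (j + 1) n` is left.
    have := lie_lie_eq_add (B j) (B n) (B 1)
    rw [h.lie_pair j n (by omega) (by omega) (by omega) le_rfl, h.lie_one j (by omega) hin,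
      h.last_lie_one, smul_lie, h.v_lie 1 le_rfl (by omega), smul_zero,
      h.lie_pair (j + 1) n (by omega) hin (by omega) le_rfl, lie_smul,
      h.lie_v (by omega) (by omega), smul_zero, add_zero] at this
    exact (h.smul_v_inj ((zero_smul ℂ v).trans this)).symm

/-- Modulo `v`, which commutes with both factors, `e_i` and `e_j` are eigenvectors of `x`, so the
eigenvalue of their nonzero product is the sum of theirs. -/
theorem weight_pair (h : AdaptedBasis n β μ a r q ω B v) {i j : ℕ} (hi : 2 ≤ i) (hin : i ≤ n)
    (hj : 2 ≤ j) (hjn : j ≤ n) (hij : ω i j ≠ 0) : μ = (i : ℂ) + j - 4 + 2 * β := by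
  have := lie_lie_eq_add (B i) (B j) (B 0)
  simp only [h.lie_pair i j hi hin hj hjn, h.lie_zero i hi hin, h.lie_zero j hj hjn, smul_lie,
    add_lie, lie_add, lie_smul, h.v_lie_zero, h.v_lie j (by omega) hjn,
    h.lie_v (show 1 ≤ i by omega) hin, smul_zero, add_zero, smul_smul, ← add_smul] at this
  have h0 := h.smul_v_inj this
  apply mul_left_cancel₀ hij
  linear_combination h0

/-- The same weight count for the product of `e_n` and `e_1`. -/
theorem weight_last (h : AdaptedBasis n β μ a r q ω B v) (hn : 2 ≤ n) (ha : a ≠ 0) :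
    μ = (n : ℂ) - 1 + β := by
  have := lie_lie_eq_add (B n) (B 1) (B 0)
  simp only [h.last_lie_one, h.lie_zero n hn le_rfl, h.one_lie_zero, smul_lie,
    add_lie, lie_add, lie_smul, h.v_lie_zero, h.v_lie 1 le_rfl (by omega),
    h.lie_v (show 1 ≤ n by omega) le_rfl, smul_zero, add_zero, smul_smul, ← add_smul] at this
  have h0 := h.smul_v_inj this
  apply mul_left_cancel₀ ha
  linear_combination h0

/-- The generators obtained from an adapted basis by a triangular change of basis. -/
def newGen (n : ℕ) (t κ z u y d : ℂ) (B : ℕ → E) (v : E) (k : ℕ) : E :=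
  if k = 0 then B 0 + y • B n
  else if k = 1 then B 1 + z • B 2 + u • v
  else if k ≤ n then t • B k + (if k = 2 then t * d else 0) • v
  else κ • v

/-! ### Triangular changes of basis. -/

section newGen

variable (t κ z u y d : ℂ)

theorem newGen_zero : newGen n t κ z u y d B v 0 = B 0 + y • B n := by simp [newGen]

theorem newGen_one : newGen n t κ z u y d B v 1 = B 1 + z • B 2 + u • v := by simp [newGen]

theorem newGen_mid {k : ℕ} (hk : 2 ≤ k) (hkn : k ≤ n) :
    newGen n t κ z u y d B v k = t • B k + (if k = 2 then t * d else 0) • v := by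
  rw [newGen, if_neg (by omega), if_neg (by omega), if_pos hkn]

theorem newGen_last (hn : 2 ≤ n) : newGen n t κ z u y d B v (n + 1) = κ • v := by
  rw [newGen, if_neg (by omega), if_neg (by omega), if_neg (by omega)]

/-- Each equation is one component of one relation: `hz` and `hu` are the `e_2`- and `v`-components
of `[e_1, x]`, `hd` is the `v`-component of `[e_2, x]`, `hzω` and `hlast` concern `[e_i, e_1]` for
`i < n` and `i = n`, and `hω` is the rescaled cocycle. The bounds leave `r' = n - 1` or `r' = n`:
the chain under `e_1` stops at `e_n` or goes on to the multiple of `v`. -/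
theorem relations_newGen (h : AdaptedBasis n β μ a r q ω B v) (hn : 2 ≤ n)
    {t κ z u y d ε : ℂ} {r' s : ℕ} {w : ℕ → ℂ}
    (hr1 : n ≤ r' + 1) (hr2 : r' ≤ n) (hs : s ≤ n + 2)
    (hz : z * β = z) (hu : r + z * q + u * μ - y * a + z * y * ω 2 n = u + ε * κ)
    (hd : q + d * μ + y * ω 2 n = β * d) (hzω : ∀ i, 2 ≤ i → i < n → z * ω i 2 = 0)
    (hlast : t * (a + z * ω n 2) = if n ≤ r' then κ else 0)
    (hω : ∀ i j, 2 ≤ i → i ≤ n → 2 ≤ j → j ≤ n →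
      t ^ 2 * ω i j = if i + j = s then (-1) ^ i * κ else 0)
    (hw : ∀ i : ℕ, 2 ≤ i → i ≤ n → w i = (i : ℂ) - 2 + β) (hwn : w (n + 1) = μ) :
    Relations 0 (n + 1) r' s ε w (newGen n t κ z u y d B v) := by
  have hc := h.isFiliformCocycle
  refine ⟨fun i hi hin => ?_, fun i j hi hij hjn => ?_, fun _ => ?_, fun _ i hi hin => ?_⟩
  · rcases Nat.lt_or_ge n i with hni | hni
    · obtain rfl : i = n + 1 := by omega
      rw [newGen_last _ _ _ _ _ _ hn, newGen_one, if_neg (by omega)]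
      simp [lie_add, smul_lie, h.v_lie 1 le_rfl (by omega), h.v_lie 2 (by omega) hn]
    · rw [newGen_mid _ _ _ _ _ _ hi hni, newGen_one]
      simp only [add_lie, lie_add, smul_lie, lie_smul, h.v_lie 1 le_rfl (by omega),
        h.v_lie 2 (by omega) hn, lie_self, h.lie_v (show 1 ≤ i by omega) hni,
        h.lie_pair i 2 hi hni le_rfl hn, smul_zero, add_zero]
      rcases hni.lt_or_eq with hlt | rfl
      · rw [if_pos (by omega), newGen_mid _ _ _ _ _ _ (by omega) hlt, h.lie_one i hi hlt,
          if_neg (show ¬ i + 1 = 2 by omega)]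
        linear_combination (norm := module) (t * hzω i hi hlt) • v
      · rw [newGen_last _ _ _ _ _ _ hn, h.last_lie_one]
        split_ifs at hlast ⊢
        all_goals linear_combination (norm := module) hlast • v
  · rw [newGen_mid _ _ _ _ _ _ hi (by omega), newGen_last _ _ _ _ _ _ hn]
    rcases Nat.lt_or_ge n j with hnj | hnj
    · obtain rfl : j = n + 1 := by omega
      rw [newGen_last _ _ _ _ _ _ hn, if_neg (show ¬ i + (n + 1) = s by omega)]
      simp only [add_lie, smul_lie, lie_smul, lie_self,
        h.lie_v (show 1 ≤ i by omega) (show i ≤ n by omega), smul_zero, add_zero]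
    · rw [newGen_mid _ _ _ _ _ _ (by omega) hnj]
      simp only [add_lie, lie_add, smul_lie, lie_smul, h.v_lie j (by omega) hnj, lie_self,
        h.lie_v (show 1 ≤ i by omega) (show i ≤ n by omega),
        h.lie_pair i j hi (by omega) (by omega) hnj, smul_zero, add_zero]
      have := hω i j hi (by omega) (by omega) hnj
      split_ifs at this ⊢
      all_goals linear_combination (norm := module) this • v
  · rw [newGen_one, newGen_zero, newGen_last _ _ _ _ _ _ hn]
    have h1n : ⁅B 1, B n⁆ = -(a • v) := by rw [← h.last_lie_one, lie_skew]
    simp only [add_lie, lie_add, smul_lie, lie_smul, h.one_lie_zero, h.lie_zero 2 le_rfl hn,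
      h.v_lie_zero, h1n, h.lie_pair 2 n le_rfl hn hn le_rfl, h.v_lie n (by omega) le_rfl, if_true]
    push_cast
    linear_combination (norm := module) hz • B 2 + hu • v
  · rw [newGen_zero]
    rcases Nat.lt_or_ge n i with hni | hni
    · obtain rfl : i = n + 1 := by omega
      rw [newGen_last _ _ _ _ _ _ hn, hwn]
      simp only [lie_add, smul_lie, lie_smul, h.v_lie_zero, h.v_lie n (by omega) le_rfl,
        smul_zero, add_zero, smul_smul, mul_comm]
    · rw [newGen_mid _ _ _ _ _ _ hi hni, hw i hi hni]
      simp only [add_lie, lie_add, smul_lie, lie_smul, h.v_lie_zero, h.v_lie n (by omega) le_rfl,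
        h.lie_zero i hi hni, h.lie_pair i n hi hni hn le_rfl]
      by_cases hi2 : i = 2
      · subst hi2
        simp only [if_true]
        push_cast
        linear_combination (norm := module) (t * hd) • v
      -- For `i ≥ 3` the vector `e_i` commutes with `e_n`, so adding `y e_n` to `x` leaves this
      -- product alone.
      · rw [if_neg hi2, if_neg hi2, hc.last i (by omega) hni]
        module

theorem surjective_newGen (h : AdaptedBasis n β μ a r q ω B v) (hn : 2 ≤ n) {t κ : ℂ}
    (z u y d : ℂ) (ht : t ≠ 0) (hκ : κ ≠ 0) :
    Function.Surjective (ofBasis (newGen n t κ z u y d B v) : Coord 0 (n + 1) →ₗ[ℂ] E) := by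
  rw [← LinearMap.range_eq_top]
  set R := LinearMap.range (ofBasis (newGen n t κ z u y d B v) : Coord 0 (n + 1) →ₗ[ℂ] E)
  have hg : ∀ k, k ≤ n + 1 → newGen n t κ z u y d B v k ∈ R := fun k hk =>
    ⟨e k, ofBasis_e _ (Finset.mem_Icc.mpr ⟨by omega, hk⟩)⟩
  have hv : v ∈ R := by
    have := hg (n + 1) le_rfl
    rw [newGen_last _ _ _ _ _ _ hn] at this
    exact (R.smul_mem_iff hκ).mp this
  have hmid : ∀ k, 2 ≤ k → k ≤ n → B k ∈ R := by
    intro k hk hkn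
    have := hg k (by omega)
    rw [newGen_mid _ _ _ _ _ _ hk hkn] at this
    exact (R.smul_mem_iff ht).mp ((R.add_mem_iff_left (R.smul_mem _ hv)).mp this)
  have hone : B 1 ∈ R := by
    have := hg 1 (by omega)
    rw [newGen_one] at this
    exact (R.add_mem_iff_left (R.smul_mem _ (hmid 2 le_rfl hn))).mp
      ((R.add_mem_iff_left (R.smul_mem _ hv)).mp this)
  have hzero : B 0 ∈ R := by
    have := hg 0 (by omega)
    rw [newGen_zero] at this
    exact (R.add_mem_iff_left (R.smul_mem _ (hmid n hn le_rfl))).mp this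
  rw [eq_top_iff]
  intro x _
  obtain ⟨c, d', rfl⟩ := h.exists_eq x
  refine R.add_mem (R.sum_mem fun k hk => R.smul_mem _ ?_) (R.smul_mem _ hv)
  have hk2 := (Finset.mem_Icc.mp hk).2
  match k, hk2 with
  | 0, _ => exact hzero
  | 1, _ => exact hone
  | k + 2, hk2 => exact hmid _ (by omega) hk2

/-- The new generators span `E` and their number is its dimension, so they form a basis. The index
bound `N` is tied to `n` by an equation so that tables on `2 * m` also fit. -/
theorem nonempty_equiv (h : AdaptedBasis n β μ a r q ω B v) (hn : 2 ≤ n)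
    {t κ z u y d ε : ℂ} {N r' s : ℕ} {w : ℕ → ℂ} {T : LieTable 0 N}
    (hN : N = n + 1) (hT : T.HasNormalForm r' s ε w) (ht : t ≠ 0) (hκ : κ ≠ 0)
    (hr1 : n ≤ r' + 1) (hr2 : r' ≤ n) (hs : s ≤ n + 2)
    (hz : z * β = z) (hu : r + z * q + u * μ - y * a + z * y * ω 2 n = u + ε * κ)
    (hd : q + d * μ + y * ω 2 n = β * d) (hzω : ∀ i, 2 ≤ i → i < n → z * ω i 2 = 0)
    (hlast : t * (a + z * ω n 2) = if n ≤ r' then κ else 0)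
    (hω : ∀ i j, 2 ≤ i → i ≤ n → 2 ≤ j → j ≤ n →
      t ^ 2 * ω i j = if i + j = s then (-1) ^ i * κ else 0)
    (hw : ∀ i : ℕ, 2 ≤ i → i ≤ n → w i = (i : ℂ) - 2 + β) (hwn : w (n + 1) = μ) :
    Nonempty (E ≃ₗ⁅ℂ⁆ T.Alg) := by
  subst hN
  have hsurj := h.surjective_newGen hn z u y d ht hκ
  refine hT.nonempty_equiv (by omega) (by omega)
    (h.relations_newGen hn hr1 hr2 hs hz hu hd hzω hlast hω hw hwn) ⟨?_, hsurj⟩ (by omega)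
  have : FiniteDimensional ℂ E := FiniteDimensional.of_finrank_pos (by rw [h.finrank_eq]; omega)
  refine (LinearMap.injective_iff_surjective_of_finrank_eq_finrank ?_).mpr hsurj
  rw [h.finrank_eq]
  simp [Coord]

end newGen

/-- The extensions in which `e n` does not commute with `e 1`, but does with `e 2`. -/
theorem nonempty_equiv_of_last_ne_zero (h : AdaptedBasis n β μ a r q ω B v) (hn : 2 ≤ n)
    (ha : a ≠ 0) (h2n : ω 2 n = 0) {t : ℂ} (ht : t ≠ 0) {s : ℕ} (hs : s ≤ n + 2)
    (hω : ∀ i j, 2 ≤ i → i ≤ n → 2 ≤ j → j ≤ n →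
      t * ω i j = if i + j = s then (-1) ^ i * a else 0)
    {w : ℕ → ℂ} (hw : ∀ i : ℕ, w i = (i : ℂ) - 2 + β)
    {T : LieTable 0 (n + 1)} (hT : T.HasNormalForm n s 0 w) : Nonempty (E ≃ₗ⁅ℂ⁆ T.Alg) := by
  have hμ := h.weight_last hn ha
  have hn1 : (1 - n : ℂ) ≠ 0 := by
    rw [sub_ne_zero]
    exact_mod_cast (show (1 : ℕ) ≠ n by omega)
  -- Adding `u v` to `e_1` changes the defect `r` by `u (μ - 1)`. At the resonance `μ = 1`, adding
  -- `y e_n` to `x` removes it instead, since `[e_1, e_n] = -a v` with `a ≠ 0`.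
  obtain ⟨u, y, huy⟩ : ∃ u y : ℂ, r + u * μ - y * a = u := by
    by_cases hμ1 : μ = 1
    · exact ⟨0, r / a, by field_simp; ring⟩
    · have : 1 - μ ≠ 0 := sub_ne_zero.mpr (Ne.symm hμ1)
      exact ⟨r / (1 - μ), 0, by field_simp; ring⟩
  -- The denominator of `d` is `β - μ = 1 - n`, so `q` can always be removed.
  refine h.nonempty_equiv hn (t := t) (κ := t * a) (z := 0) (u := u) (y := y)
    (d := q / (1 - n)) rfl hT ht (mul_ne_zero ht ha) (by omega) le_rfl hs (by ring)
    (by linear_combination huy) ?_ (by simp) (by simp) ?_ (fun i _ _ => hw i) ?_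
  · rw [h2n, hμ]; field_simp; ring
  · intro i j hi hin hj hjn
    rw [pow_two, mul_assoc, hω i j hi hin hj hjn]
    split_ifs <;> ring
  · rw [hw, hμ]; push_cast; ring

/-- The extensions in which `e n` does not commute with `e 2`. -/
theorem nonempty_equiv_tau (h : AdaptedBasis n β μ a r q ω B v) (hn : 2 ≤ n) {m : ℕ}
    (hm : n + 1 = 2 * m) (h2n : ω 2 n ≠ 0)
    (hω : ∀ i j, 2 ≤ i → i ≤ n → 2 ≤ j → j ≤ n →
      ω i j = if i + j = n + 2 then (-1) ^ i * ω 2 n else 0) :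
    Nonempty (E ≃ₗ⁅ℂ⁆ (tau1 m β).Alg) ∨
      (β = (3 - (n : ℂ)) / 2 ∧ Nonempty (E ≃ₗ⁅ℂ⁆ (tau2 m).Alg)) := by
  have hmC : (n : ℂ) + 1 = 2 * m := by exact_mod_cast hm
  have hμ := h.weight_pair le_rfl hn hn le_rfl h2n
  push_cast at hμ
  set c := ω 2 n with hc
  have hn2 : ω n 2 = -c := h.isFiliformCocycle.swap n 2 hn le_rfl le_rfl hn
  -- Replacing `e_1` by `e_1 + (a / c) e_2` makes it commute with `e_n`. Modulo `v` it keeps the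
  -- eigenvalue `1` under `x`: if `a ≠ 0`, the two weight formulas for `v` force `β = 1`.
  have hz : a / c * β = a / c := by
    by_cases ha : a = 0
    · simp [ha]
    · have := h.weight_last hn ha
      rw [show β = 1 by linear_combination this - hμ, mul_one]
  have hzω : ∀ i, 2 ≤ i → i < n → a / c * ω i 2 = 0 := by
    intro i hi hin
    rw [hω i 2 hi hin.le le_rfl hn, if_neg (by omega), mul_zero]
  have hlast : a + a / c * ω n 2 = 0 := by rw [hn2]; field_simp; ring
  -- The defect `q` is absorbed by adding `d v` to `e_2`, or, when `μ = β`, by adding `y e_n` to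
  -- `x`, using `[e_2, e_n] = c v`.
  obtain ⟨y, d, hyd⟩ : ∃ y d : ℂ, q + d * μ + y * c = β * d := by
    by_cases hμβ : μ = β
    · exact ⟨-q / c, 0, by field_simp; ring⟩
    · have : β - μ ≠ 0 := sub_ne_zero.mpr (Ne.symm hμβ)
      exact ⟨0, q / (β - μ), by field_simp; ring⟩
  have hya : a / c * y * c = y * a := by field_simp
  have hω2 : ∀ t : ℂ, ∀ i j, 2 ≤ i → i ≤ n → 2 ≤ j → j ≤ n →
      t ^ 2 * ω i j = if i + j = 2 * m + 1 then (-1) ^ i * (t ^ 2 * c) else 0 := by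
    intro t i j hi hin hj hjn
    rw [hω i j hi hin hj hjn, ← hm]
    split_ifs <;> ring
  -- The defect of the modified `e_1` is `r + (a / c) q`; the contributions of `y` cancel by `hya`.
  -- Adding `u v` to `e_1` removes it unless `μ = 1`, which is how `τ²` arises.
  by_cases hτ : μ = 1 ∧ r + a / c * q ≠ 0
  · right
    obtain ⟨hμ1, hρ⟩ := hτ
    have hβ : β = (3 - (n : ℂ)) / 2 := by linear_combination (hμ1 - hμ) / 2
    refine ⟨hβ, ?_⟩
    -- Scaling `e_2, …, e_n` by `t` makes the last basis vector `t² c v`; this square root makes it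
    -- equal to the defect, so that `[e_1, x] = e_1 + e_{2m}`.
    obtain ⟨t, ht⟩ := IsAlgClosed.exists_pow_nat_eq ((r + a / c * q) / c) (n := 2) two_pos
    have hsq : t ^ 2 * c = r + a / c * q := by rw [ht, div_mul_cancel₀ _ h2n]
    have ht0 : t ≠ 0 := by
      rintro rfl
      apply hρ
      rw [← hsq]; ring
    refine h.nonempty_equiv hn (t := t) (κ := t ^ 2 * c) (z := a / c) (u := 0) (y := y) (d := d)
      hm.symm (tau2_hasNormalForm m) ht0 (mul_ne_zero (pow_ne_zero 2 ht0) h2n) (by omega)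
      (by omega) (by omega) hz (by linear_combination hya - hsq) hyd hzω
      (by rw [hlast, if_neg (by omega), mul_zero]) (hω2 t) ?_ ?_
    · intro i hi hin
      rw [if_neg (by omega), hβ]
      linear_combination hmC / 2
    · rw [if_pos hm, hμ1]
  · left
    obtain ⟨u, hu⟩ : ∃ u : ℂ, r + a / c * q + u * μ = u := by
      by_cases hμ1 : μ = 1
      · have : r + a / c * q = 0 := by
          by_contra hρ
          exact hτ ⟨hμ1, hρ⟩
        exact ⟨0, by rw [this]; ring⟩
      · have : 1 - μ ≠ 0 := sub_ne_zero.mpr (Ne.symm hμ1)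
        generalize r + a / c * q = ρ
        exact ⟨ρ / (1 - μ), by field_simp; ring⟩
    refine h.nonempty_equiv hn (t := 1) (κ := 1 ^ 2 * c) (z := a / c) (u := u) (y := y) (d := d)
      hm.symm (tau1_hasNormalForm m β) one_ne_zero (by simpa using h2n) (by omega)
      (by omega) (by omega) hz (by linear_combination hya + hu) hyd hzω
      (by rw [hlast, if_neg (by omega), mul_zero]) (hω2 1) ?_ ?_
    · intro i hi hin
      rw [if_neg (by omega)]
    · rw [if_pos hm, hμ]
      linear_combination -hmC

/-- The type is decided by the position of the only antidiagonal on which `ω` can be nonzero. -/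
theorem classification (h : AdaptedBasis n β μ a r q ω B v) (hn : 2 ≤ n)
    (hns : a ≠ 0 ∨ ω 2 n ≠ 0) :
    Nonempty (E ≃ₗ⁅ℂ⁆ (s1 (n + 1) β).Alg) ∨
    (∃ m : ℕ, n + 1 = 2 * m ∧
      (Nonempty (E ≃ₗ⁅ℂ⁆ (tau1 m β).Alg) ∨
        (β = (3 - (n : ℂ)) / 2 ∧ Nonempty (E ≃ₗ⁅ℂ⁆ (tau2 m).Alg)))) ∨
    (∃ (k : ℕ) (hk : k ≤ n / 2), 2 ≤ k ∧ β = (n : ℂ) + 2 - 2 * (k : ℂ) ∧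
      Nonempty (E ≃ₗ⁅ℂ⁆ (solvL n k hk).Alg)) := by
  have hc := h.isFiliformCocycle
  by_cases h0 : ∀ i j, 2 ≤ i → i ≤ n → 2 ≤ j → j ≤ n → ω i j = 0
  · left
    have h2n := h0 2 n le_rfl hn hn le_rfl
    refine h.nonempty_equiv_of_last_ne_zero hn (hns.resolve_right (not_not.mpr h2n)) h2n
      one_ne_zero (s := 0) (by omega) ?_ (fun i => rfl) (s1_hasNormalForm (n + 1) β)
    intro i j hi hin hj hjn
    rw [h0 i j hi hin hj hjn, if_neg (by omega), mul_zero]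
  right
  push Not at h0
  obtain ⟨i₀, j₀, hi₀, hin₀, hj₀, hjn₀, hne⟩ := h0
  have hle : i₀ + j₀ ≤ n + 2 := by
    by_contra hlt
    exact hne (hc.eq_zero_of_lt hin₀ hj₀ hjn₀ (by omega))
  obtain ⟨k, hk⟩ : Odd (i₀ + j₀) := by
    rw [← Nat.not_even_iff_odd]
    exact fun he => hne (hc.eq_zero_of_even hi₀ hin₀ hj₀ hjn₀ he)
  have hkC : (i₀ : ℂ) + j₀ = 2 * k + 1 := by exact_mod_cast hk
  have hμ := h.weight_pair hi₀ hin₀ hj₀ hjn₀ hne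
  have hcne : ω 2 (2 * k - 1) ≠ 0 := by
    intro h1
    apply hne
    rw [hc.eq_of_le hi₀ hin₀ hj₀ hle, show i₀ + j₀ - 2 = 2 * k - 1 by omega, h1, mul_zero]
  -- A nonzero entry determines `i + j` through `μ`, so no second antidiagonal can occur.
  have hω : ∀ i j, 2 ≤ i → i ≤ n → 2 ≤ j → j ≤ n →
      ω i j = if i + j = 2 * k + 1 then (-1) ^ i * ω 2 (2 * k - 1) else 0 := by
    intro i j hi hin hj hjn
    split_ifs with hij
    · rw [hc.eq_of_le hi hin hj (by omega), show i + j - 2 = 2 * k - 1 by omega]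
    · by_contra h1
      have hμ' := h.weight_pair hi hin hj hjn h1
      have : (i : ℂ) + j = 2 * k + 1 := by linear_combination hμ - hμ' + hkC
      exact hij (by exact_mod_cast this)
  -- This is the antidiagonal of `ω 2 n`; on any shorter one `e_n` commutes with `e_2`, and
  -- non-splitness forces `a ≠ 0`.
  by_cases hkn : 2 * k + 1 = n + 2
  · left
    rw [show 2 * k - 1 = n by omega] at hω hcne
    rw [hkn] at hω
    exact ⟨k, by omega, h.nonempty_equiv_tau hn (by omega) hcne hω⟩
  · right
    have h2n : ω 2 n = 0 := by
      rw [hω 2 n le_rfl hn hn le_rfl, if_neg (by omega)]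
    have ha := hns.resolve_right (not_not.mpr h2n)
    have hβ : β = (n : ℂ) + 2 - 2 * (k : ℂ) := by
      linear_combination h.weight_last hn ha - hμ - hkC
    have hkn2 : k ≤ n / 2 := by omega
    refine ⟨k, hkn2, by omega, hβ, ?_⟩
    -- Scaling `e_2, …, e_n` by `t` multiplies `a` by `t` but `ω` by `t²`; this `t` makes the two
    -- coefficients agree up to the sign `(-1)^i`.
    refine h.nonempty_equiv_of_last_ne_zero hn ha h2n (t := a / ω 2 (2 * k - 1))
      (div_ne_zero ha hcne) (s := 2 * k + 1) (by omega) ?_ (fun i => by rw [hβ]; ring)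
      (solvL_hasNormalForm n k hkn2)
    intro i j hi hin hj hjn
    rw [hω i j hi hin hj hjn]
    split_ifs
    · field_simp
    · ring

end AdaptedBasis

end Adapted

end FiliformExt

end

noncomputable section

namespace FiliformExt

/-! ### From a non-split extension to an adapted basis. -/

open LieTable

/-- The lifts of `e 2, e 3, …` obtained from a lift of `e 2` by iterated products with a lift of
`e 1`; the first two terms are the given lifts of `e 0` and `e 1`. -/
def liftGen {E : Type*} [LieRing E] (x₀ x₁ x₂ : E) : ℕ → E
  | 0 => x₀
  | 1 => x₁
  | 2 => x₂
  | k + 3 => ⁅liftGen x₀ x₁ x₂ (k + 2), x₁⁆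

theorem liftGen_succ {E : Type*} [LieRing E] (x₀ x₁ x₂ : E) {k : ℕ} (hk : 2 ≤ k) :
    ⁅liftGen x₀ x₁ x₂ k, liftGen x₀ x₁ x₂ 1⁆ = liftGen x₀ x₁ x₂ (k + 1) := by
  obtain ⟨k, rfl⟩ := Nat.exists_eq_add_of_le' hk
  rfl

/-- Every structure constant appears because the difference between a product of lifts and the
expected lift lies in the kernel of `p`, the line of `v`. The condition on the centre enters twice:
it makes `v` central in the nilradical, and it prevents `e_n` from being so. -/
theorem IsNonsplitExtension.exists_adaptedBasis {V E : Type*} [LieRing V] [LieAlgebra ℂ V]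
    [LieRing E] [LieAlgebra ℂ E] {n : ℕ} {β : ℂ} {i : V →ₗ⁅ℂ⁆ E} {p : E →ₗ⁅ℂ⁆ (s1 n β).Alg}
    (hn : 2 ≤ n) (hV : Module.finrank ℂ V = 1) (h : IsNonsplitExtension i p) :
    ∃ (μ a r q : ℂ) (ω : ℕ → ℕ → ℂ) (B : ℕ → E) (v : E), AdaptedBasis n β μ a r q ω B v ∧
      (a ≠ 0 ∨ ω 2 n ≠ 0) := by
  have hT := s1_hasNormalForm n β
  have hrel := hT.relations_gen (by omega) (by omega)
  have hnil := hT.nilradical_eq hn (by omega)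
  have hinj : Function.Injective i := by
    rw [← LieHom.ker_eq_bot]; exact h.isExtension.ker_eq_bot
  have hsurj : Function.Surjective p := by
    rw [← LieHom.range_eq_top]; exact h.isExtension.range_eq_top
  have hexact : ∀ y, y ∈ i.range ↔ p y = 0 := by
    intro y
    have : y ∈ i.range ↔ y ∈ p.ker := by
      have := h.isExtension.exact
      rw [LieHom.range_eq_ker_iff] at this
      rw [LieHom.mem_ker, LieHom.mem_range]
      exact (this y).symm
    rw [this, LieHom.mem_ker]
  have hmem : ∀ y, y ∈ nilradical E ↔ coeff 0 ((s1 n β).toCoord (p y)) = 0 := by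
    intro y
    rw [h.nilradical_eq, LieIdeal.mem_comap, hnil, hT.mem_ideal]
  obtain ⟨v₀, hv₀, hspan⟩ := finrank_eq_one_iff'.mp hV
  set v := i v₀ with hv
  have hvne : v ≠ 0 := fun h0 => hv₀ (hinj (by rw [← hv, h0, map_zero]))
  have hker : ∀ y, p y = 0 → ∃ c : ℂ, y = c • v := by
    intro y hy
    obtain ⟨w, rfl⟩ := (hexact y).mpr hy
    obtain ⟨c, rfl⟩ := hspan w
    exact ⟨c, map_smul i c v₀⟩
  have hpv : p v = 0 := (hexact v).mp ⟨v₀, rfl⟩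
  have hvlie : ∀ z ∈ nilradical E, ⁅v, z⁆ = 0 := ((h.center_eq v).mpr ⟨v₀, rfl⟩).2
  obtain ⟨x₀, hx₀⟩ := hsurj ((s1 n β).gen 0)
  obtain ⟨x₁, hx₁⟩ := hsurj ((s1 n β).gen 1)
  obtain ⟨x₂, hx₂⟩ := hsurj ((s1 n β).gen 2)
  set B := liftGen x₀ x₁ x₂ with hB
  have hpB : ∀ k, k ≤ n → p (B k) = (s1 n β).gen k := by
    intro k
    induction k with
    | zero => exact fun _ => hx₀
    | succ k ih =>
      intro hk
      rcases Nat.lt_or_ge k 2 with hk2 | hk2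
      · interval_cases k
        · exact hx₁
        · exact hx₂
      · rw [hB, ← liftGen_succ x₀ x₁ x₂ hk2, LieHom.map_lie, ← hB, ih (by omega),
          show p (B 1) = (s1 n β).gen 1 from hx₁, hrel.lie_one k hk2 (by omega),
          if_pos (by omega)]
  have hBnil : ∀ k, 1 ≤ k → k ≤ n → B k ∈ nilradical E := by
    intro k hk hkn
    rw [hmem, hpB k hkn]
    exact hT.gen_mem_ideal hn hk
  have hvB : ∀ k, 1 ≤ k → k ≤ n → ⁅v, B k⁆ = 0 := fun k hk hkn => hvlie _ (hBnil k hk hkn)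
  have hdecomp : ∀ y, ∃ d : ℂ,
      y = ∑ k ∈ Finset.Icc 0 n, coeff k ((s1 n β).toCoord (p y)) • B k + d • v := by
    intro y
    obtain ⟨d, hd⟩ := hker
      (y - ∑ k ∈ Finset.Icc 0 n, coeff k ((s1 n β).toCoord (p y)) • B k) (by
        rw [map_sub, map_sum, sub_eq_zero]
        conv_lhs => rw [(s1 n β).eq_sum_gen (p y)]
        refine Finset.sum_congr rfl fun k hk => ?_
        rw [map_smul, hpB k (Finset.mem_Icc.mp hk).2])
    exact ⟨d, by rw [← hd]; abel⟩
  have hfin : Module.finrank ℂ E = n + 2 := by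
    have : FiniteDimensional ℂ E := by
      classical
      refine ⟨⟨insert v ((Finset.Icc 0 n).image B), ?_⟩⟩
      rw [eq_top_iff]
      intro y _
      obtain ⟨d, hd⟩ := hdecomp y
      rw [hd]
      refine Submodule.add_mem _ (Submodule.sum_mem _ fun k hk => Submodule.smul_mem _ _
        (Submodule.subset_span ?_)) (Submodule.smul_mem _ _ (Submodule.subset_span ?_))
      · simp only [Finset.coe_insert, Finset.coe_image]
        exact Or.inr ⟨k, hk, rfl⟩
      · simp
    have hrk := LinearMap.finrank_range_add_finrank_ker (p : E →ₗ[ℂ] (s1 n β).Alg)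
    have h1 : LinearMap.range (p : E →ₗ[ℂ] (s1 n β).Alg) = ⊤ := LinearMap.range_eq_top.mpr hsurj
    have h2 : LinearMap.ker (p : E →ₗ[ℂ] (s1 n β).Alg) = Submodule.span ℂ {v} := by
      ext y
      rw [Submodule.mem_span_singleton]
      constructor
      · intro hy
        obtain ⟨c, hc⟩ := hker y hy
        exact ⟨c, hc.symm⟩
      · rintro ⟨c, rfl⟩
        change p (c • v) = 0
        rw [map_smul, hpv, smul_zero]
    have h3 : Module.finrank ℂ (s1 n β).Alg = n + 1 := by
      rw [(s1 n β).toCoord.finrank_eq]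
      simp [Coord]
    rw [h1, h2, finrank_top, finrank_span_singleton hvne, h3] at hrk
    omega
  obtain ⟨μ, hμ⟩ := hker ⁅v, B 0⁆ (by rw [LieHom.map_lie, hpv, zero_lie])
  obtain ⟨a, ha⟩ := hker ⁅B n, B 1⁆ (by
    rw [LieHom.map_lie, hpB n le_rfl, hpB 1 (by omega), hrel.lie_one n hn le_rfl,
      if_neg (by omega)])
  obtain ⟨r, hr⟩ := hker (⁅B 1, B 0⁆ - B 1) (by
    rw [map_sub, LieHom.map_lie, hpB 1 (by omega), hpB 0 (by omega), hrel.one_lie_zero rfl]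
    simp)
  obtain ⟨q, hq⟩ := hker (⁅B 2, B 0⁆ - β • B 2) (by
    rw [map_sub, map_smul, LieHom.map_lie, hpB 2 hn, hpB 0 (by omega),
      hrel.lie_zero rfl 2 le_rfl hn]
    simp)
  -- The bounds sit inside the existential so that `choose` gives a function of the two indices
  -- alone, with the value `0` available outside the range.
  have hpair : ∀ j k, ∃ c : ℂ, 2 ≤ j → j ≤ n → 2 ≤ k → k ≤ n → ⁅B j, B k⁆ = c • v := by
    intro j k
    by_cases hjk : 2 ≤ j ∧ j ≤ n ∧ 2 ≤ k ∧ k ≤ n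
    · obtain ⟨hj, hjn, hk, hkn⟩ := hjk
      obtain ⟨c, hc⟩ := hker ⁅B j, B k⁆ (by
        rw [LieHom.map_lie, hpB j hjn, hpB k hkn]
        rcases lt_trichotomy j k with hlt | rfl | hlt
        · rw [hrel.lie_pair j k hj hlt hkn, if_neg (by omega)]
        · exact lie_self _
        · rw [← lie_skew, hrel.lie_pair k j hk hlt hjn, if_neg (by omega), neg_zero])
      exact ⟨c, fun _ _ _ _ => hc⟩
    · exact ⟨0, fun h1 h2 h3 h4 => absurd ⟨h1, h2, h3, h4⟩ hjk⟩
  choose ω hω using hpair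
  -- Only `e_2` carries a defect: in `[[e_k, e_1], x]` the terms in `q v` and `r v` are bracketed
  -- with `e_1` and `e_k`, and vanish.
  have hzero : ∀ k, 2 ≤ k → k ≤ n →
      ⁅B k, B 0⁆ = ((k : ℂ) - 2 + β) • B k + (if k = 2 then q else 0) • v := by
    intro k hk
    induction k, hk using Nat.le_induction with
    | base =>
      intro _
      rw [sub_eq_iff_eq_add] at hq
      rw [hq, if_pos rfl]
      push_cast
      module
    | succ k hk ih =>
      intro hkn
      rw [sub_eq_iff_eq_add] at hr
      rw [if_neg (by omega), hB, ← liftGen_succ x₀ x₁ x₂ hk, ← hB, lie_lie_eq_add,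
        ih (by omega), hr]
      have h1 : ⁅B k, v⁆ = 0 := by rw [← lie_skew, hvB k (by omega) (by omega), neg_zero]
      simp only [add_lie, lie_add, smul_lie, lie_smul, hvB 1 le_rfl (by omega), h1]
      push_cast
      module
  have hA : AdaptedBasis n β μ a r q ω B v :=
    { ne_zero := hvne
      exists_eq := fun y => ⟨_, hdecomp y⟩
      finrank_eq := hfin
      v_lie := hvB
      v_lie_zero := hμ
      lie_one := fun k hk _ => liftGen_succ x₀ x₁ x₂ hk
      last_lie_one := ha
      lie_pair := hω
      one_lie_zero := by rw [sub_eq_iff_eq_add] at hr; rw [hr, add_comm]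
      lie_zero := hzero }
  refine ⟨μ, a, r, q, ω, B, v, hA, ?_⟩
  by_contra! hsplit
  obtain ⟨ha0, h2n⟩ := hsplit
  have hc := hA.isFiliformCocycle
  -- With `a = 0` and `ω 2 n = 0`, the vector `e_n` commutes with `e_1` and `e_2`, and it commutes
  -- with the later `e_k` in any case. It would then lie in the image of `V`, although its image in
  -- the quotient is nonzero.
  have hcentral : ∀ z ∈ nilradical E, ⁅B n, z⁆ = 0 := by
    intro z hz
    rw [hmem] at hz
    obtain ⟨d, hd⟩ := hdecomp z
    rw [hd, lie_add, lie_smul, hA.lie_v (by omega) le_rfl, smul_zero, add_zero, lie_sum]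
    refine Finset.sum_eq_zero fun k hk => ?_
    have hkn := (Finset.mem_Icc.mp hk).2
    rw [lie_smul]
    match k, hkn with
    | 0, _ => rw [hz, zero_smul]
    | 1, _ => rw [ha, ha0, zero_smul, smul_zero]
    | k + 2, hkn =>
      have hkn0 : ω n (k + 2) = 0 := by
        rw [hc.swap n (k + 2) hn le_rfl (by omega) hkn]
        rcases Nat.eq_zero_or_pos k with rfl | hk0
        · rw [h2n, neg_zero]
        · rw [hc.last (k + 2) (by omega) hkn, neg_zero]
      rw [hω n (k + 2) hn le_rfl (by omega) hkn, hkn0, zero_smul, smul_zero]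
  have hBn := (h.center_eq (B n)).mp ⟨hBnil n (by omega) le_rfl, hcentral⟩
  rw [hexact, hpB n le_rfl] at hBn
  have hnI : n ∈ Finset.Icc 0 n := by simp
  have := congrArg (fun u => coeff n ((s1 n β).toCoord u)) hBn
  simp only [toCoord_gen, coeff_e hnI, map_zero] at this
  simp at this

end FiliformExt

end

theorem theorem5p9 (n : ℕ) (hn : 2 ≤ n) (β : ℂ) :
    (∀ (V : Type*) (E : Type*) [LieRing V] [LieAlgebra ℂ V] [LieRing E] [LieAlgebra ℂ E]
      (i : V →ₗ⁅ℂ⁆ E) (p : E →ₗ⁅ℂ⁆ (FiliformExt.s1 n β).Alg),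
      Module.finrank ℂ V = 1 → FiliformExt.IsNonsplitExtension i p →
        Nonempty (E ≃ₗ⁅ℂ⁆ (FiliformExt.s1 (n + 1) β).Alg) ∨
        (∃ m : ℕ, n + 1 = 2 * m ∧
          (Nonempty (E ≃ₗ⁅ℂ⁆ (FiliformExt.tau1 m β).Alg) ∨
            (β = (3 - (n : ℂ)) / 2 ∧ Nonempty (E ≃ₗ⁅ℂ⁆ (FiliformExt.tau2 m).Alg)))) ∨
        (∃ (k : ℕ) (hk : k ≤ n / 2), 2 ≤ k ∧ β = (n : ℂ) + 2 - 2 * (k : ℂ) ∧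
          Nonempty (E ≃ₗ⁅ℂ⁆ (FiliformExt.solvL n k hk).Alg))) ∧
    (∀ (k : ℕ) (hk : k ≤ n / 2), 2 ≤ k →
      Nonempty (FiliformExt.nilradical (FiliformExt.solvL n k hk).Alg
        ≃ₗ⁅ℂ⁆ (FiliformExt.nilL n k hk).Alg)) := by
  refine ⟨fun V E _ _ _ _ i p hV h => ?_, FiliformExt.nonempty_nilradical_solvL_equiv n⟩
  obtain ⟨μ, a, r, q, ω, B, v, hA, hns⟩ := h.exists_adaptedBasis hn hV
  exact hA.classification hn hns
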